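/- Let $K$ be a non-archimedean local field with real-valued valuation $\omega$, ring of integers $\mathcal O_K$ and maximal ideal $\mathfrak m_K$. Let $D$ be a finite-dimensional central division algebra over $K$, let $d$ be its degree (so $\dim_K D=d^2$), let $\omega$ also denote the unique valuation of $D$ extending that of $K$ (with $\omega(0)=\infty$), let $\mathcal O_D=\{x\in D:\omega(x)\ge 0\}$, $\mathfrak m_D=\{x\in D:\omega(x)>0\}$, and let $\pi_D$ be a uniformiser, $\mathcal O_D\pi_D=\mathfrak m_D$. For a matrix $g$ and a real matrix $m$ write $\omega(g)\ge m$ if $\omega(g_{ij})\ge m_{ij}$ for all $i,j$. *The tree.* Let $\mathrm{SL}_2(D)$ be the group of $2\times2$ matrices over $D$ of reduced norm $1$. For $x\in\mathbf R$ put $$P_x=\Big\{g\in \mathrm{SL}_2(D): \omega(g)\ge\begin{pmatrix}0&-x\\x&0\end{pmatrix}\Big\},$$ so that $P_0=\mathrm{SL}_2(\mathcal O_D)$. Let $N=T\sqcup M$, where $T$ is the set of matrices $\begin{pmatrix}x&0\\0&x^{-1}\end{pmatrix}$ and $M$ the set of matrices $\begin{pmatrix}0&-x\\x^{-1}&0\end{pmatrix}$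 with $x\in D^\times$. For $n\in N$ let $\nu(n)$ be the affine map of $\mathbf R$ which is the translation by $-2\omega(x)$ in the first case and the reflection through $-\omega(x)$ in the second. Define $(g,x)\sim(h,y)$ on $\mathrm{SL}_2(D)\times\mathbf R$ if there is $n\in N$ with $y=\nu(n)(x)$ and $g^{-1}hn\in P_x$. The Bruhat–Tits tree is $\mathcal I=(\mathrm{SL}_2(D)\times\mathbf R)/\!\sim$, with classes $[(g,x)]$ and with $\mathrm{SL}_2(D)$ acting by multiplication on the first component. It carries the distance $d_{\mathcal I}$ for which $d_{\mathcal I}([(g,x)],[(g,y)])=|x-y|/\omega(\pi_D)$ for all $g,x,y$ (any two points lie in a common apartment $\{[(g,x)]:x\in\mathbf R\}$). For $m\in\mathbf N$ let $B_0(m)$ be the closed ball of radius $m$ around $[(\mathrm{Id},0)]$. *The local tree.* Let $r\in\mathbf N$. Let $P_0^{0,rd}=\mathrm{SL}_2(\mathcal O_D/\mathfrak m_D^{rd})$ be the group of $2\times2$ matrices over $\mathcal O_D/\mathfrak m_D^{rd}$ whose reduced norm, an element of $\mathcal O_K/\mathfrak m_K^{r}$, equals $1$; that is, a lift $g$ to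 $\mathcal O_D$ satisfies $\mathrm{Nrd}(g)\equiv 1 \bmod \mathfrak m_K^r$. Let $p_{rd}\colon P_0\to P_0^{0,rd}$ be the reduction of the entries. Let $\omega$ also denote the map induced on $\mathcal O_D/\mathfrak m_D^{rd}$ (with $\omega(0)=\infty$), and for $x\in J:=[-\omega(\pi_D^{rd}),\omega(\pi_D^{rd})]$ put $$P_x^{0,rd}=\Big\{g\in P_0^{0,rd}:\omega(g)\ge\begin{pmatrix}0&-x\\x&0\end{pmatrix}\Big\}.$$ Let $N^{0,rd}\subset P_0^{0,rd}$ consist of the matrices $\begin{pmatrix}x&0\\0&x^{-1}\end{pmatrix}$, with $\nu$ the identity of $\mathbf R$, and of the matrices $\begin{pmatrix}0&-x\\x^{-1}&0\end{pmatrix}$, with $\nu$ the reflection through $0$, where $\omega(x)=0$. Let $\sim_{0,rd}$ be the equivalence relation on $P_0^{0,rd}\times J$ for which $(g,x)\sim_{0,rd}(h,y)$ if there is $n\in N^{0,rd}$ with $\nu(n)(x)=y$ and $g^{-1}hn\in P_x^{0,rd}$. (If $r=0$, then $P_0^{0,0}\times J$ is a single point.) Let $\mathcal I^{0,rd}=(P_0^{0,rd}\times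 J)/\!\sim_{0,rd}$, with classes $[(g,x)]^{0,rd}$ and with $P_0^{0,rd}$ acting by multiplication on the first component. **Theorem.** For every $r\in\mathbf N$, the ball $B_0(rd)$ is the set of points $[(g,x)]$ with $g\in P_0$ and $x\in J$, it is stable under $P_0$, and $$B_0(rd)\to\mathcal I^{0,rd},\qquad [(g,x)]\mapsto[(p_{rd}(g),x)]^{0,rd}\quad(g\in P_0,\ x\in J),$$ is a well-defined bijection which is equivariant along $p_{rd}\colon P_0\to P_0^{0,rd}$, i.e. $k\cdot b$ has image $p_{rd}(k)$ times the image of $b$, for all $k\in P_0$ and $b\in B_0(rd)$. -/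

import Mathlib

open scoped TensorProduct ENNReal

namespace BTTree

noncomputable section

section Splitting

/-- The degree of a central division algebra: the square root of its dimension. -/
def degree (K D : Type*) [Field K] [DivisionRing D] [Algebra K D] : ℕ :=
  Nat.sqrt (Module.finrank K D)

theorem isSimpleRing_tensor (K D L : Type*) [Field K] [DivisionRing D] [Algebra K D]
    [Algebra.IsCentral K D] [Field L] [Algebra K L] : IsSimpleRing (D ⊗[K] L) := by
  classical
  have : Nontrivial (D ⊗[K] L) := inferInstance
  refine ⟨⟨fun I => ?_⟩⟩
  by_cases hI : I = ⊥
  · exact Or.inl hI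
  right
  let b := Module.Basis.ofVectorSpace K L
  let B := Algebra.TensorProduct.basis D b
  have hmulR : ∀ (z : D ⊗[K] L) (d : D) (i), B.repr (z * (d ⊗ₜ[K] (1 : L))) i = B.repr z i * d := by
    intro z d i
    induction z using TensorProduct.induction_on with
    | zero => simp
    | tmul x y =>
      simp [B, Algebra.TensorProduct.basis_repr_tmul, Algebra.TensorProduct.tmul_mul_tmul,
        mul_assoc, Algebra.commutes]
    | add x y hx hy => simp [add_mul, hx, hy]
  have hmulL : ∀ (z : D ⊗[K] L) (d : D) (i), B.repr ((d ⊗ₜ[K] (1 : L)) * z) i = d * B.repr z i := by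
    intro z d i
    have : (d ⊗ₜ[K] (1 : L)) * z = d • z := by
      induction z using TensorProduct.induction_on with
      | zero => simp
      | tmul x y => simp [TensorProduct.smul_tmul']
      | add x y hx hy => simp [mul_add, hx, hy]
    rw [this]; simp
  have hex : ∃ n : ℕ, ∃ z ∈ I, z ≠ 0 ∧ (B.repr z).support.card = n := by
    by_contra hcon
    apply hI
    ext z
    constructor
    · intro hz
      by_contra h0
      exact hcon ⟨_, z, hz, fun h => h0 (h ▸ TwoSidedIdeal.zero_mem _), rfl⟩
    · intro hz
      rw [TwoSidedIdeal.mem_bot] at hz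
      rw [hz]; exact I.zero_mem
  obtain ⟨z, hzI, hz0, hzc⟩ := Nat.find_spec hex
  have hmin : ∀ w ∈ I, (B.repr w).support.card < (B.repr z).support.card → w = 0 := by
    intro w hw hlt
    by_contra hw0
    exact Nat.find_min hex (hzc ▸ hlt) ⟨w, hw, hw0, rfl⟩
  obtain ⟨i₀, hi₀⟩ : ∃ i, B.repr z i ≠ 0 := by
    by_contra hcon
    push Not at hcon
    exact hz0 (B.repr.map_eq_zero_iff.1 (Finsupp.ext hcon))
  set c := B.repr z i₀ with hc
  set z' := (c⁻¹ ⊗ₜ[K] (1 : L)) * z with hz'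
  have hz'I : z' ∈ I := I.mul_mem_left _ _ hzI
  have hz'i : B.repr z' i₀ = 1 := by rw [hz', hmulL, ← hc, inv_mul_cancel₀ hi₀]
  have hsub : (B.repr z').support ⊆ (B.repr z).support := by
    intro i hi
    rw [Finsupp.mem_support_iff] at hi ⊢
    intro h
    exact hi (by rw [hz', hmulL, h, mul_zero])
  have hcomm : ∀ (d : D) i, d * B.repr z' i = B.repr z' i * d := by
    intro d i
    have h0 : (d ⊗ₜ[K] (1 : L)) * z' - z' * (d ⊗ₜ[K] (1 : L)) = 0 := by
      apply hmin _ (I.sub_mem (I.mul_mem_left _ _ hz'I) (I.mul_mem_right _ _ hz'I))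
      apply Finset.card_lt_card
      refine ⟨fun j hj => ?_, fun hss => ?_⟩
      · apply hsub
        rw [Finsupp.mem_support_iff] at hj ⊢
        intro h
        apply hj
        rw [map_sub, Finsupp.sub_apply, hmulL, hmulR, h]; simp
      · have := hss (Finsupp.mem_support_iff.2 hi₀)
        rw [Finsupp.mem_support_iff, map_sub, Finsupp.sub_apply, hmulL, hmulR, hz'i] at this
        simp at this
    have := congrArg (fun w => B.repr w i) h0
    simp only [map_sub, Finsupp.sub_apply, hmulL, hmulR, map_zero, Finsupp.zero_apply] at this
    exact sub_eq_zero.1 this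
  have hcen : ∀ i, ∃ k : K, algebraMap K D k = B.repr z' i := by
    intro i
    have : B.repr z' i ∈ Subalgebra.center K D :=
      Subalgebra.mem_center_iff.2 fun d => hcomm d i
    exact Algebra.mem_bot.1 (Algebra.IsCentral.out this)
  choose k hk using hcen
  obtain ⟨l, hl⟩ : ∃ l : L, z' = (1 : D) ⊗ₜ[K] l := by
    refine ⟨∑ i ∈ (B.repr z').support, k i • b i, ?_⟩
    conv_lhs => rw [← B.linearCombination_repr z']
    rw [Finsupp.linearCombination_apply, Finsupp.sum, TensorProduct.tmul_sum]
    refine Finset.sum_congr rfl fun i _ => ?_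
    rw [← hk i, Algebra.TensorProduct.basis_apply, TensorProduct.smul_tmul', smul_eq_mul, mul_one,
      Algebra.algebraMap_eq_smul_one, TensorProduct.smul_tmul]
  have hl0 : l ≠ 0 := by
    rintro rfl
    rw [hl] at hz'i
    simp at hz'i
  have h1 : (1 : D ⊗[K] L) ∈ I := by
    have := I.mul_mem_left ((1 : D) ⊗ₜ[K] l⁻¹) _ hz'I
    rwa [hl, Algebra.TensorProduct.tmul_mul_tmul, one_mul, inv_mul_cancel₀ hl0] at this
  exact (TwoSidedIdeal.one_mem_iff I).1 h1

theorem exists_splitting (K D : Type*) [Field K] [DivisionRing D] [Algebra K D]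
    [FiniteDimensional K D] [Algebra.IsCentral K D] :
    Nonempty (D →ₐ[K] Matrix (Fin (degree K D)) (Fin (degree K D)) (AlgebraicClosure K)) := by
  let L := AlgebraicClosure K
  have := isSimpleRing_tensor K D L
  have : IsSimpleRing (L ⊗[K] D) :=
    IsSimpleRing.of_ringEquiv (Algebra.TensorProduct.comm K D L).toRingEquiv inferInstance
  obtain ⟨n, _, ⟨e⟩⟩ := IsSimpleRing.exists_algEquiv_matrix_of_isAlgClosed L (L ⊗[K] D)
  have hn : Module.finrank K D = n * n := by
    rw [← Module.finrank_baseChange (R := L) (S := K) (M' := D), e.toLinearEquiv.finrank_eq,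
      Module.finrank_matrix]
    simp
  have hd : degree K D = n := by rw [degree, hn, Nat.sqrt_eq]
  rw [hd]
  exact ⟨(e.toAlgHom.restrictScalars K).comp Algebra.TensorProduct.includeRight⟩

end Splitting

section Valuation

set_option linter.unusedSectionVars false

/-- A splitting `D → M_d(K̄)`. All choices are conjugate under `GL_d(K̄)`, so reduced norms
do not depend on the choice. -/
def splitting (K D : Type*) [Field K] [DivisionRing D] [Algebra K D]
    [FiniteDimensional K D] [Algebra.IsCentral K D] :
    D →ₐ[K] Matrix (Fin (degree K D)) (Fin (degree K D)) (AlgebraicClosure K) :=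
  (exists_splitting K D).some

/-- The reduced norm of `M_n(D)`, with values in `K ⊆ K̄`: the determinant of the
`nd × nd` matrix obtained by applying the splitting to every entry. -/
def nrd (K D : Type*) [Field K] [DivisionRing D] [Algebra K D]
    [FiniteDimensional K D] [Algebra.IsCentral K D] (n : ℕ) :
    Matrix (Fin n) (Fin n) D →* AlgebraicClosure K where
  toFun g := (Matrix.comp _ _ _ _ _ (g.map (splitting K D))).det
  map_one' := by
    have := map_one (((Matrix.compRingEquiv (Fin n) (Fin (degree K D))
      (AlgebraicClosure K)).toRingHom).comp (splitting K D).toRingHom.mapMatrix)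
    exact (congrArg Matrix.det this).trans Matrix.det_one
  map_mul' g h := by
    have := map_mul (((Matrix.compRingEquiv (Fin n) (Fin (degree K D))
      (AlgebraicClosure K)).toRingHom).comp (splitting K D).toRingHom.mapMatrix) g h
    exact (congrArg Matrix.det this).trans (Matrix.det_mul _ _)

variable (K : Type*) {D : Type*} [NontriviallyNormedField K] [IsUltrametricDist K]
  [CompleteSpace K] [DivisionRing D] [Algebra K D] [FiniteDimensional K D]
  [Algebra.IsCentral K D]

/-- The absolute value of `D` extending that of `K`, namely `|x| = |Nrd x| ^ (1/d)`; here the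
absolute value of `K` is extended to `K̄` by the spectral norm. -/
def absD (x : D) : ℝ :=
  spectralNorm K (AlgebraicClosure K) (splitting K D x).det ^ (1 / (degree K D : ℝ))

/-- The real number `ω(x) = -log |x|`, for `x ≠ 0`. -/
def realVal (x : D) : ℝ := -Real.log (absD K x)

open Classical in
/-- The valuation `ω` of `D`, with `ω(0) = ∞`. -/
def val (x : D) : EReal := if x = 0 then ⊤ else (realVal K x : EReal)

theorem spectralNorm_mul' (x y : AlgebraicClosure K) :
    spectralNorm K (AlgebraicClosure K) (x * y) =
      spectralNorm K (AlgebraicClosure K) x * spectralNorm K (AlgebraicClosure K) y :=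
  spectralAlgNorm_mul x y

theorem degree_pos : 0 < degree K D := by
  rw [degree, Nat.sqrt_pos]; exact Module.finrank_pos

theorem absD_nonneg (x : D) : 0 ≤ absD K x :=
  Real.rpow_nonneg (spectralNorm_nonneg _) _

theorem absD_pow (x : D) : absD K x ^ degree K D =
    spectralNorm K (AlgebraicClosure K) (splitting K D x).det := by
  have hd : (degree K D : ℝ) ≠ 0 := by exact_mod_cast (degree_pos K (D := D)).ne'
  rw [absD, ← Real.rpow_natCast, ← Real.rpow_mul (spectralNorm_nonneg _), one_div,
    inv_mul_cancel₀ hd, Real.rpow_one]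

theorem absD_mul (x y : D) : absD K (x * y) = absD K x * absD K y := by
  rw [absD, map_mul, Matrix.det_mul, spectralNorm_mul',
    Real.mul_rpow (spectralNorm_nonneg _) (spectralNorm_nonneg _)]; rfl

theorem absD_one : absD K (1 : D) = 1 := by
  rw [absD, map_one, Matrix.det_one, spectralNorm_one, Real.one_rpow]

theorem absD_zero : absD K (0 : D) = 0 := by
  have : Nonempty (Fin (degree K D)) := ⟨⟨0, degree_pos K⟩⟩
  have h := absD_pow K (0 : D)
  rw [map_zero, Matrix.det_zero, spectralNorm_zero] at h
  exact eq_zero_of_pow_eq_zero h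

theorem absD_ne_zero {x : D} (hx : x ≠ 0) : absD K x ≠ 0 := by
  intro h
  have := absD_mul K x x⁻¹
  rw [mul_inv_cancel₀ hx, absD_one, h, zero_mul] at this
  exact one_ne_zero this

theorem absD_pos {x : D} (hx : x ≠ 0) : 0 < absD K x :=
  lt_of_le_of_ne (absD_nonneg K x) (absD_ne_zero K hx).symm

theorem absD_inv (x : D) : absD K x⁻¹ = (absD K x)⁻¹ := by
  by_cases hx : x = 0
  · simp [hx, absD_zero]
  · have := absD_mul K x x⁻¹
    rw [mul_inv_cancel₀ hx, absD_one] at this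
    exact eq_inv_of_mul_eq_one_right this.symm

theorem absD_neg (x : D) : absD K (-x) = absD K x := by
  have h1 : absD K (-1 : D) = 1 := by
    have h := absD_mul K (-1 : D) (-1)
    rw [neg_mul_neg, one_mul, absD_one] at h
    have h0 := absD_nonneg K (-1 : D)
    nlinarith
  rw [← neg_one_mul, absD_mul, h1, one_mul]

/-- All eigenvalues of a split element have the same absolute value. -/
theorem spectralNorm_root (x : D) {l : AlgebraicClosure K}
    (hl : l ∈ (splitting K D x).charpoly.roots) :
    spectralNorm K (AlgebraicClosure K) l = spectralValue (minpoly K x) := by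
  have hx : IsIntegral K x := Algebra.IsIntegral.isIntegral x
  have hroot : Polynomial.aeval l (minpoly K x) = 0 := by
    have hmem : l ∈ spectrum (AlgebraicClosure K) (splitting K D x) :=
      Matrix.mem_spectrum_iff_isRoot_charpoly.2 (Polynomial.isRoot_of_mem_roots hl)
    have h2 := spectrum.subset_polynomial_aeval (splitting K D x)
      ((minpoly K x).map (algebraMap K (AlgebraicClosure K))) ⟨l, hmem, rfl⟩
    rw [Polynomial.aeval_map_algebraMap, Polynomial.aeval_algHom_apply, minpoly.aeval, map_zero]
      at h2
    have : Nonempty (Fin (degree K D)) := ⟨⟨0, degree_pos K⟩⟩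
    rw [spectrum.zero_eq, Set.mem_singleton_iff] at h2
    rw [← Polynomial.eval_map_algebraMap]
    exact h2
  rw [spectralNorm, ← minpoly.eq_of_irreducible_of_monic (minpoly.irreducible hx) hroot
    (minpoly.monic hx)]

theorem spectralNorm_multiset_prod (s : Multiset (AlgebraicClosure K)) :
    spectralNorm K (AlgebraicClosure K) s.prod =
      (s.map (spectralNorm K (AlgebraicClosure K))).prod := by
  induction s using Multiset.induction with
  | empty => simp [spectralNorm_one]
  | cons a s ih => simp [spectralNorm_mul', ih]

theorem spectralNorm_neg' (x : AlgebraicClosure K) :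
    spectralNorm K (AlgebraicClosure K) (-x) = spectralNorm K (AlgebraicClosure K) x :=
  spectralNorm_neg (Algebra.IsAlgebraic.isAlgebraic x)

theorem multiset_prod_le_one (s : Multiset ℝ) (h : ∀ y ∈ s, 0 ≤ y ∧ y ≤ 1) : s.prod ≤ 1 := by
  induction s using Multiset.induction with
  | empty => simp
  | cons a s ih =>
    rw [Multiset.prod_cons]
    have h1 := h a (Multiset.mem_cons_self a s)
    have h2 := ih fun y hy => h y (Multiset.mem_cons_of_mem hy)
    have h3 : 0 ≤ s.prod := Multiset.prod_nonneg fun y hy => (h y (Multiset.mem_cons_of_mem hy)).1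
    exact mul_le_one₀ h1.2 h3 h2

theorem absD_one_add_le {x : D} (hx : absD K x ≤ 1) : absD K (1 + x) ≤ 1 := by
  set A := splitting K D x with hA
  have hcard : A.charpoly.roots.card = degree K D := by
    rw [IsAlgClosed.card_roots_eq_natDegree, Matrix.charpoly_natDegree_eq_dim, Fintype.card_fin]
  have hs : spectralValue (minpoly K x) ≤ 1 := by
    have h1 : absD K x ^ degree K D = spectralValue (minpoly K x) ^ degree K D := by
      rw [absD_pow, ← hA, Matrix.det_eq_prod_roots_charpoly, spectralNorm_multiset_prod,
        Multiset.map_congr rfl (fun l hl => spectralNorm_root K x hl), Multiset.map_const',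
        Multiset.prod_replicate, hcard]
    rw [pow_left_inj₀ (absD_nonneg K x) (spectralValue_nonneg _) (degree_pos K).ne'] at h1
    rwa [← h1]
  have hdet : spectralNorm K (AlgebraicClosure K) (1 + A).det =
      spectralNorm K (AlgebraicClosure K) (A.charpoly.eval (-1)) := by
    have h1 : Matrix.scalar (Fin (degree K D)) (-1 : AlgebraicClosure K) - A = -(1 + A) := by
      rw [map_neg, map_one]; abel
    rw [Matrix.eval_charpoly, h1, Matrix.det_neg]
    rcases neg_one_pow_eq_or (AlgebraicClosure K) (Fintype.card (Fin (degree K D))) with h | h <;>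
      rw [h]
    · rw [one_mul]
    · rw [neg_one_mul, spectralNorm_neg']
  have hle : spectralNorm K (AlgebraicClosure K) (A.charpoly.eval (-1)) ≤ 1 := by
    rw [(IsAlgClosed.splits A.charpoly).eq_prod_roots_of_monic (Matrix.charpoly_monic A),
      Polynomial.eval_multiset_prod, spectralNorm_multiset_prod]
    refine multiset_prod_le_one _ fun y hy => ⟨?_, ?_⟩
    all_goals
      simp only [Multiset.map_map, Multiset.mem_map, Function.comp] at hy
      obtain ⟨l, hl, rfl⟩ := hy
    · exact spectralNorm_nonneg _
    · rw [Polynomial.eval_sub, Polynomial.eval_X, Polynomial.eval_C, ← spectralNorm_neg', neg_sub,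
        sub_neg_eq_add]
      refine (isNonarchimedean_spectralNorm l 1).trans (max_le ?_ ?_)
      · rwa [spectralNorm_root K x hl]
      · rw [spectralNorm_one]
  have h2 : absD K (1 + x) ^ degree K D ≤ 1 := by
    rw [absD_pow, map_add, map_one, ← hA, hdet]; exact hle
  exact (pow_le_one_iff_of_nonneg (absD_nonneg K _) (degree_pos K).ne').1 h2

theorem absD_add_le (x y : D) : absD K (x + y) ≤ max (absD K x) (absD K y) := by
  wlog h : absD K y ≤ absD K x generalizing x y
  · rw [add_comm, max_comm]; exact this y x (le_of_not_ge h)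
  rw [max_eq_left h]
  by_cases hx : x = 0
  · subst hx
    rwa [zero_add]
  have h1 : absD K (x⁻¹ * y) ≤ 1 := by
    rw [absD_mul, absD_inv, inv_mul_le_one₀ (absD_pos K hx)]; exact h
  have h2 : x + y = x * (1 + x⁻¹ * y) := by rw [mul_add, mul_one, mul_inv_cancel_left₀ hx]
  rw [h2, absD_mul]
  exact mul_le_of_le_one_right (absD_nonneg K x) (absD_one_add_le K h1)

theorem absD_sub_le (x y : D) : absD K (x - y) ≤ max (absD K x) (absD K y) := by
  rw [sub_eq_add_neg, ← absD_neg K y]; exact absD_add_le K x (-y)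

theorem le_val_iff (c : ℝ) (x : D) : (c : EReal) ≤ val K x ↔ absD K x ≤ Real.exp (-c) := by
  by_cases hx : x = 0
  · simp [hx, val, absD_zero, Real.exp_nonneg]
  · rw [val, if_neg hx, EReal.coe_le_coe_iff, realVal, le_neg,
      Real.log_le_iff_le_exp (absD_pos K hx)]

theorem zero_le_val_iff (x : D) : 0 ≤ val K x ↔ absD K x ≤ 1 := by
  have := le_val_iff K 0 x
  rwa [neg_zero, Real.exp_zero, EReal.coe_zero] at this

theorem zero_lt_val_iff (x : D) : 0 < val K x ↔ absD K x < 1 := by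
  by_cases hx : x = 0
  · simp [hx, val, absD_zero]
  · rw [val, if_neg hx, EReal.coe_pos, realVal, neg_pos, Real.log_neg_iff (absD_pos K hx)]

end Valuation

section Integers

set_option linter.unusedSectionVars false

variable (K : Type*) (D : Type*) [NontriviallyNormedField K] [IsUltrametricDist K]
  [CompleteSpace K] [DivisionRing D] [Algebra K D] [FiniteDimensional K D]
  [Algebra.IsCentral K D]

/-- The ring of integers `O_D = {x | 0 ≤ ω(x)}`. -/
def intD : Subring D where
  carrier := {x | 0 ≤ val K x}
  zero_mem' := by simp [val]
  one_mem' := by simp [zero_le_val_iff, absD_one]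
  add_mem' {x y} hx hy := by
    simp only [Set.mem_ofPred_eq, zero_le_val_iff] at *
    exact (absD_add_le K x y).trans (max_le hx hy)
  mul_mem' {x y} hx hy := by
    simp only [Set.mem_ofPred_eq, zero_le_val_iff] at *
    rw [absD_mul]
    exact mul_le_one₀ hx (absD_nonneg K y) hy
  neg_mem' {x} hx := by
    simp only [Set.mem_ofPred_eq, zero_le_val_iff] at *
    rwa [absD_neg]

/-- The maximal ideal `m_D = {x | 0 < ω(x)}` of `O_D`. -/
def maxD : Ideal (intD K D) where
  carrier := {x | 0 < val K (x : D)}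
  zero_mem' := by simp [val]
  add_mem' {x y} hx hy := by
    simp only [Set.mem_ofPred_eq, zero_lt_val_iff] at *
    exact (absD_add_le K (x : D) y).trans_lt (max_lt hx hy)
  smul_mem' c x hx := by
    have hc := (zero_le_val_iff K (c : D)).1 c.2
    simp only [Set.mem_ofPred_eq, zero_lt_val_iff] at *
    rw [smul_eq_mul, Subring.coe_mul, absD_mul]
    exact mul_lt_one_of_nonneg_of_lt_one_right hc (absD_nonneg K _) hx

instance maxD_isTwoSided : (maxD K D).IsTwoSided where
  mul_mem_of_left {a} b ha := by
    have hb := (zero_le_val_iff K (b : D)).1 b.2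
    have ha' := (zero_lt_val_iff K (a : D)).1 ha
    change 0 < val K ((a * b : intD K D) : D)
    rw [zero_lt_val_iff, Subring.coe_mul, absD_mul]
    exact mul_lt_one_of_nonneg_of_lt_one_left (absD_nonneg K _) ha' hb

/-- The ring `O_D / m_D ^ m`. -/
abbrev Quo (m : ℕ) : Type _ := intD K D ⧸ (maxD K D ^ m)

variable {D}

/-- The map induced by `ω` on `O_D / m_D ^ m`: the class of `y ∉ m_D ^ m` has valuation `ω(y)`,
and the zero class has valuation `∞`. -/
def quoVal {m : ℕ} (z : Quo K D m) : EReal :=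
  ⨆ (y : intD K D) (_ : Ideal.Quotient.mk (maxD K D ^ m) y = z), val K (y : D)

end Integers

section Groups

set_option linter.unusedSectionVars false

variable (K : Type*) (D : Type*) [NontriviallyNormedField K] [IsUltrametricDist K]
  [CompleteSpace K] [DivisionRing D] [Algebra K D] [FiniteDimensional K D]
  [Algebra.IsCentral K D]

/-- `SL_2(D)`: the invertible `2 × 2` matrices over `D` of reduced norm `1`. -/
def SL2 : Subgroup (GL (Fin 2) D) := (Units.map (nrd K D 2)).ker

/-- The matrix `(0, -x; x, 0)` bounding the valuations of the elements of `P_x`. -/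
def levelMat (x : ℝ) : Matrix (Fin 2) (Fin 2) ℝ := !![0, -x; x, 0]

variable {D}

/-- `ω(g) ≥ m`, entry by entry. -/
def ValGE (g : Matrix (Fin 2) (Fin 2) D) (m : Matrix (Fin 2) (Fin 2) ℝ) : Prop :=
  ∀ i j, (m i j : EReal) ≤ val K (g i j)

theorem valGE_levelMat_iff (g : Matrix (Fin 2) (Fin 2) D) (x : ℝ) :
    ValGE K g (levelMat x) ↔ absD K (g 0 0) ≤ 1 ∧ absD K (g 0 1) ≤ Real.exp x ∧
      absD K (g 1 0) ≤ (Real.exp x)⁻¹ ∧ absD K (g 1 1) ≤ 1 := by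
  simp only [ValGE, Fin.forall_fin_two, le_val_iff, levelMat]
  simp [Real.exp_neg, and_assoc]

theorem valGE_mul {g h : Matrix (Fin 2) (Fin 2) D} {x : ℝ} (hg : ValGE K g (levelMat x))
    (hh : ValGE K h (levelMat x)) : ValGE K (g * h) (levelMat x) := by
  rw [valGE_levelMat_iff] at *
  obtain ⟨g1, g2, g3, g4⟩ := hg
  obtain ⟨h1, h2, h3, h4⟩ := hh
  have hX := Real.exp_pos x
  have hX' := inv_pos.2 hX
  have key : ∀ {a b : D} {s t u : ℝ}, 0 ≤ s → s * t = u → absD K a ≤ s → absD K b ≤ t →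
      absD K (a * b) ≤ u := fun {a b s t u} hs hu ha hb => by
    rw [absD_mul, ← hu]
    exact mul_le_mul ha hb (absD_nonneg K b) hs
  simp only [Matrix.mul_apply, Fin.sum_univ_two]
  refine ⟨?_, ?_, ?_, ?_⟩ <;> refine (absD_add_le K _ _).trans (max_le ?_ ?_)
  · exact key zero_le_one (one_mul 1) g1 h1
  · exact key hX.le (mul_inv_cancel₀ hX.ne') g2 h3
  · exact key zero_le_one (one_mul _) g1 h2
  · exact key hX.le (mul_one _) g2 h4
  · exact key hX'.le (mul_one _) g3 h1
  · exact key zero_le_one (one_mul _) g4 h3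
  · exact key hX'.le (inv_mul_cancel₀ hX.ne') g3 h2
  · exact key zero_le_one (one_mul 1) g4 h4

theorem valGE_one (x : ℝ) : ValGE K (1 : Matrix (Fin 2) (Fin 2) D) (levelMat x) := by
  rw [valGE_levelMat_iff]
  simp [absD_one, absD_zero, Real.exp_nonneg]

/-- The identification of two blocks of size `d` with `Fin 2 × Fin d`. -/
def blockEquiv (d : ℕ) : Fin d ⊕ Fin d ≃ Fin 2 × Fin d where
  toFun := Sum.elim (fun i => (0, i)) fun i => (1, i)
  invFun p := if p.1 = 0 then Sum.inl p.2 else Sum.inr p.2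
  left_inv := by rintro (i | i) <;> simp
  right_inv := by
    rintro ⟨i, j⟩
    fin_cases i <;> simp

theorem nrd_eq (a b c e : D) : nrd K D 2 !![a, b; c, e] =
    (Matrix.fromBlocks (splitting K D a) (splitting K D b) (splitting K D c)
      (splitting K D e)).det := by
  change (Matrix.comp _ _ _ _ _ ((!![a, b; c, e] : Matrix _ _ D).map (splitting K D))).det = _
  rw [← Matrix.det_submatrix_equiv_self (blockEquiv (degree K D))]
  congr 1
  ext (i | i) (j | j) <;> rfl

theorem nrd_lower (a c e : D) : nrd K D 2 !![a, 0; c, e] =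
    (splitting K D a).det * (splitting K D e).det := by
  rw [nrd_eq, map_zero, Matrix.det_fromBlocks_zero₁₂]

theorem nrd_schur {a : D} (b c e : D) (ha : a ≠ 0) : nrd K D 2 !![a, b; c, e] =
    (splitting K D a).det * (splitting K D (e - c * a⁻¹ * b)).det := by
  have h : (!![a, b; c, e] : Matrix (Fin 2) (Fin 2) D) =
      !![a, 0; c, e - c * a⁻¹ * b] * !![1, a⁻¹ * b; 0, 1] := by
    simp [mul_assoc, mul_inv_cancel_left₀ ha]
  rw [h, map_mul, nrd_lower, nrd_eq K 1, map_zero, Matrix.det_fromBlocks_zero₂₁]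
  simp

theorem inv_formula {a s : D} (b c : D) (ha : a ≠ 0) (hs : s ≠ 0) :
    (!![a, b; c, s + c * a⁻¹ * b] : Matrix (Fin 2) (Fin 2) D) *
        !![a⁻¹ + a⁻¹ * b * s⁻¹ * c * a⁻¹, -(a⁻¹ * b * s⁻¹); -(s⁻¹ * c * a⁻¹), s⁻¹] = 1 ∧
      !![a⁻¹ + a⁻¹ * b * s⁻¹ * c * a⁻¹, -(a⁻¹ * b * s⁻¹); -(s⁻¹ * c * a⁻¹), s⁻¹] *
        (!![a, b; c, s + c * a⁻¹ * b] : Matrix (Fin 2) (Fin 2) D) = 1 := by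
  constructor
  · simp [Matrix.one_fin_two, mul_add, add_mul, mul_assoc, ha, hs]
  · simp [Matrix.one_fin_two, mul_add, add_mul, mul_assoc, ha, hs]

/-- Inversion of a matrix of reduced norm of absolute value `1` preserves `ω(g) ≥ m_x`. -/
theorem exists_inv {g : Matrix (Fin 2) (Fin 2) D} {x : ℝ} (hg : ValGE K g (levelMat x))
    (hn : spectralNorm K (AlgebraicClosure K) (nrd K D 2 g) = 1) :
    ∃ h : Matrix (Fin 2) (Fin 2) D, g * h = 1 ∧ h * g = 1 ∧ ValGE K h (levelMat x) := by
  obtain ⟨a, b, c, e, rfl⟩ : ∃ a b c e, g = !![a, b; c, e] :=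
    ⟨_, _, _, _, Matrix.eta_fin_two g⟩
  rw [valGE_levelMat_iff] at hg
  simp only [Matrix.of_apply, Matrix.cons_val', Matrix.cons_val_zero, Matrix.cons_val_one,
    Matrix.cons_val_fin_one] at hg
  obtain ⟨ha, hb, hc, he⟩ := hg
  have hX := Real.exp_pos x
  set X := Real.exp x with hXdef
  have hd := (degree_pos K (D := D)).ne'
  have hprod : ∀ {u v : D}, spectralNorm K (AlgebraicClosure K)
      ((splitting K D u).det * (splitting K D v).det) = 1 → absD K u * absD K v = 1 := by
    intro u v h
    rw [spectralNorm_mul', ← absD_pow, ← absD_pow, ← mul_pow] at h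
    exact (pow_eq_one_iff_of_nonneg (mul_nonneg (absD_nonneg K u) (absD_nonneg K v)) hd).1 h
  have hne : ∀ {u v : D}, absD K u * absD K v = 1 → u ≠ 0 ∧ v ≠ 0 := by
    intro u v h
    constructor <;> rintro rfl <;> simp [absD_zero] at h
  by_cases h1 : absD K a = 1
  · have ha0 : a ≠ 0 := by rintro rfl; simp [absD_zero] at h1
    set s := e - c * a⁻¹ * b with hs
    rw [nrd_schur K b c e ha0] at hn
    have hs1 := hprod hn
    have hs0 := (hne hs1).2
    rw [← hs, h1, one_mul] at hs1
    have hes : e = s + c * a⁻¹ * b := by rw [hs]; abel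
    refine ⟨!![a⁻¹ + a⁻¹ * b * s⁻¹ * c * a⁻¹, -(a⁻¹ * b * s⁻¹); -(s⁻¹ * c * a⁻¹), s⁻¹],
      ?_, ?_, ?_⟩
    · rw [hes]; exact (inv_formula b c ha0 hs0).1
    · rw [hes]; exact (inv_formula b c ha0 hs0).2
    · rw [valGE_levelMat_iff]
      simp only [Matrix.of_apply, Matrix.cons_val', Matrix.cons_val_zero, Matrix.cons_val_one,
        Matrix.cons_val_fin_one, absD_neg, absD_mul, absD_inv, h1, hs1, inv_one, one_mul, mul_one]
      refine ⟨(absD_add_le K _ _).trans (max_le ?_ ?_), hb, hc, le_refl _⟩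
      · rw [absD_inv, h1, inv_one]
      · simp only [absD_mul, absD_inv, h1, hs1, inv_one, one_mul, mul_one]
        calc absD K b * absD K c ≤ X * X⁻¹ := mul_le_mul hb hc (absD_nonneg K c) hX.le
          _ = 1 := mul_inv_cancel₀ hX.ne'
  · have hlt : absD K a < 1 := lt_of_le_of_ne ha h1
    have hb0 : b ≠ 0 := by
      rintro rfl
      rw [nrd_lower] at hn
      have h2 := hprod hn
      have h3 : absD K a * absD K e < 1 := mul_lt_one_of_nonneg_of_lt_one_left (absD_nonneg K a) hlt he
      exact h3.ne h2
    set s := c - e * b⁻¹ * a with hs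
    have hsw : (!![a, b; c, e] : Matrix (Fin 2) (Fin 2) D) = !![b, a; e, c] * !![0, 1; 1, 0] := by
      simp
    have hw : spectralNorm K (AlgebraicClosure K)
        (nrd K D 2 (!![0, 1; 1, 0] : Matrix (Fin 2) (Fin 2) D)) = 1 := by
      have h2 : (!![0, 1; 1, 0] : Matrix (Fin 2) (Fin 2) D) * !![0, 1; 1, 0] = 1 := by
        simp [Matrix.one_fin_two]
      have h3 := congrArg (fun z => spectralNorm K (AlgebraicClosure K) (nrd K D 2 z)) h2
      simp only [map_mul, map_one, spectralNorm_mul', spectralNorm_one] at h3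
      have h4 := spectralNorm_nonneg (K := K)
        (nrd K D 2 (!![0, 1; 1, 0] : Matrix (Fin 2) (Fin 2) D))
      nlinarith
    rw [hsw, map_mul, spectralNorm_mul', hw, mul_one, nrd_schur K a e c hb0, ← hs] at hn
    have hs1 := hprod hn
    have hs0 := (hne hs1).2
    have hbpos := absD_pos K hb0
    have hspos := absD_pos K hs0
    have hces : c = s + e * b⁻¹ * a := by rw [hs]; abel
    have hsc : absD K s ≤ absD K c := by
      have h2 : absD K (e * b⁻¹ * a) < absD K s := by
        rw [absD_mul, absD_mul, absD_inv, eq_inv_of_mul_eq_one_right hs1]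
        calc absD K e * (absD K b)⁻¹ * absD K a ≤ 1 * (absD K b)⁻¹ * absD K a := by
              gcongr
              exact absD_nonneg K a
          _ = (absD K b)⁻¹ * absD K a := by rw [one_mul]
          _ < (absD K b)⁻¹ * 1 := mul_lt_mul_of_pos_left hlt (inv_pos.2 hbpos)
          _ = (absD K b)⁻¹ := mul_one _
      rcases le_max_iff.1 (hs ▸ absD_sub_le K c (e * b⁻¹ * a)) with h3 | h3
      · exact h3
      · exact absurd h3 (not_le.2 h2)
    have hsX : absD K s ≤ X⁻¹ := hsc.trans hc
    have hbX : absD K b = X := by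
      refine le_antisymm hb ?_
      rw [eq_inv_of_mul_eq_one_right hs1] at hsX
      exact (inv_le_inv₀ hbpos hX).1 hsX
    have hsX' : absD K s = X⁻¹ := by rw [eq_inv_of_mul_eq_one_right hs1, hbX]
    have hinv := inv_formula a e hb0 hs0
    rw [← hces] at hinv
    refine ⟨!![0, 1; 1, 0] * !![b⁻¹ + b⁻¹ * a * s⁻¹ * e * b⁻¹, -(b⁻¹ * a * s⁻¹);
      -(s⁻¹ * e * b⁻¹), s⁻¹], ?_, ?_, ?_⟩
    · have h2 : (!![a, b; c, e] : Matrix (Fin 2) (Fin 2) D) * !![0, 1; 1, 0] = !![b, a; e, c] := by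
        simp
      rw [← mul_assoc, h2, hinv.1]
    · have h2 : (!![0, 1; 1, 0] : Matrix (Fin 2) (Fin 2) D) * !![0, 1; 1, 0] = 1 := by
        simp [Matrix.one_fin_two]
      rw [hsw, mul_assoc, ← mul_assoc _ !![b, a; e, c], hinv.2, one_mul, h2]
    · have hN := absD_nonneg K (D := D)
      rw [valGE_levelMat_iff]
      simp only [Matrix.mul_fin_two, Matrix.of_apply, Matrix.cons_val', Matrix.cons_val_zero,
        Matrix.cons_val_one, Matrix.cons_val_fin_one, absD_neg, absD_mul, absD_inv, zero_mul,
        one_mul, zero_add, add_zero, hbX, hsX', inv_inv]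
      refine ⟨?_, le_refl _, (absD_add_le K _ _).trans (max_le ?_ ?_), ?_⟩
      · calc X * absD K e * X⁻¹ = absD K e := by field_simp
          _ ≤ 1 := he
      · rw [absD_inv, hbX]
      · simp only [absD_mul, absD_inv, hbX, hsX', inv_inv]
        calc X⁻¹ * absD K a * X * absD K e * X⁻¹ = absD K a * absD K e * X⁻¹ := by field_simp
          _ ≤ 1 * X⁻¹ := by
            gcongr
            exact mul_le_one₀ ha (hN e) he
          _ = X⁻¹ := one_mul _
      · calc X⁻¹ * absD K a * X = absD K a := by field_simp
          _ ≤ 1 := ha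

variable (D)

/-- The subgroup `P_x = {g ∈ SL_2(D) | ω(g) ≥ (0, -x; x, 0)}`. -/
def P (x : ℝ) : Subgroup (SL2 K D) where
  carrier := {g | ValGE K ((g : GL (Fin 2) D) : Matrix (Fin 2) (Fin 2) D) (levelMat x)}
  one_mem' := valGE_one K x
  mul_mem' hg hh := valGE_mul K hg hh
  inv_mem' {g} hg := by
    have h1 : nrd K D 2 ((g : GL (Fin 2) D) : Matrix (Fin 2) (Fin 2) D) = 1 :=
      congrArg Units.val (MonoidHom.mem_ker.1 g.2)
    obtain ⟨h, hgh, -, hv⟩ := exists_inv K hg (by rw [h1, spectralNorm_one])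
    have h2 : (((g⁻¹ : SL2 K D) : GL (Fin 2) D) : Matrix (Fin 2) (Fin 2) D) = h := by
      rw [Subgroup.coe_inv]
      exact Units.inv_eq_of_mul_eq_one_right hgh
    change ValGE K (((g⁻¹ : SL2 K D) : GL (Fin 2) D) : Matrix (Fin 2) (Fin 2) D) (levelMat x)
    rwa [h2]

/-- The subset `T` of diagonal matrices `(x, 0; 0, x⁻¹)` in `SL_2(D)`. For noncommutative `D`, using
all diagonal matrices of reduced norm `1` instead (and likewise in `M` below) gives the same
relation `TreeRel`, since a diagonal matrix of reduced norm `1` with entries of valuation `0` lies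
in every `P_x`. -/
def T : Set (SL2 K D) :=
  {n | ∃ x : D, x ≠ 0 ∧ ((n : GL (Fin 2) D) : Matrix (Fin 2) (Fin 2) D) = !![x, 0; 0, x⁻¹]}

/-- The subset `M` of matrices `(0, -x; x⁻¹, 0)` in `SL_2(D)`. -/
def M : Set (SL2 K D) :=
  {n | ∃ x : D, x ≠ 0 ∧ ((n : GL (Fin 2) D) : Matrix (Fin 2) (Fin 2) D) = !![0, -x; x⁻¹, 0]}

/-- `N = T ⊔ M`. -/
def N : Set (SL2 K D) := T K D ∪ M K D

variable {D}

open Classical in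
/-- The affine action `ν` of `N` on `ℝ`: the matrix `(x, 0; 0, x⁻¹)` is sent to the translation by
`-2ω(x)`, and `(0, -x; x⁻¹, 0)` to the reflection through `-ω(x)`. It is only used on `N`. -/
def nu (n : SL2 K D) : ℝ ≃ᵃ[ℝ] ℝ :=
  if n ∈ T K D then
    AffineEquiv.constVAdd ℝ ℝ (-2 * realVal K (((n : GL (Fin 2) D) : Matrix (Fin 2) (Fin 2) D) 0 0))
  else
    AffineEquiv.pointReflection ℝ
      (-realVal K (-((n : GL (Fin 2) D) : Matrix (Fin 2) (Fin 2) D) 0 1))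

variable (D)

/-- The relation `(g, x) ∼ (h, y)` on `SL_2(D) × ℝ`. -/
def TreeRel (p q : SL2 K D × ℝ) : Prop :=
  ∃ n ∈ N K D, q.2 = nu K n p.2 ∧ p.1⁻¹ * q.1 * n ∈ P K D p.2

/-- The Bruhat–Tits tree of `SL_2(D)`: the quotient of `SL_2(D) × ℝ` by `TreeRel`. -/
def Tree : Type _ := Quot (TreeRel K D)

variable {D}

/-- The class `[(g, x)]` in the tree. -/
def Tree.mk (g : SL2 K D) (x : ℝ) : Tree K D := Quot.mk _ (g, x)

variable (D)

/-- `SL_2(D)` acts on the tree by multiplication on the first component. -/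
instance Tree.mulAction : MulAction (SL2 K D) (Tree K D) where
  smul k := Quot.map (fun p => (k * p.1, p.2)) (by
    rintro p q ⟨n, hn, h1, h2⟩
    refine ⟨n, hn, h1, ?_⟩
    have : (k * p.1)⁻¹ * (k * q.1) * n = p.1⁻¹ * q.1 * n := by group
    rwa [this])
  one_smul p := by
    induction p using Quot.ind with
    | _ p => exact congrArg (Quot.mk _) (Prod.ext (one_mul _) rfl)
  mul_smul k l p := by
    induction p using Quot.ind with
    | _ p => exact congrArg (Quot.mk _) (Prod.ext (mul_assoc _ _ _) rfl)

variable {D}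

/-- The distance of the tree, normalised by `d_ℝ(0, ω(π)) = 1`: the distance of two points is the
distance of their coordinates in a common apartment `x ↦ [(g, x)]`. -/
def treeDist (π : intD K D) (p q : Tree K D) : ℝ≥0∞ :=
  ⨅ (g : SL2 K D) (x : ℝ) (y : ℝ) (_ : Tree.mk K g x = p) (_ : Tree.mk K g y = q),
    ENNReal.ofReal (|x - y| / realVal K (π : D))

/-- The closed ball of radius `m` around the base vertex `[(1, 0)]`. -/
def ball (π : intD K D) (m : ℕ) : Set (Tree K D) :=
  {p | treeDist K π (Tree.mk K 1 0) p ≤ m}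

end Groups

section Local

set_option linter.unusedSectionVars false

variable (K : Type*) (D : Type*) [NontriviallyNormedField K] [IsUltrametricDist K]
  [CompleteSpace K] [DivisionRing D] [Algebra K D] [FiniteDimensional K D]
  [Algebra.IsCentral K D]

open scoped NormedField Valued in
/-- `z ∈ K̄` lies in `O_K` and is congruent to `1` modulo `m_K ^ r`. -/
def CongrOne (r : ℕ) (z : AlgebraicClosure K) : Prop :=
  ∃ c : 𝒪[K], z = algebraMap K (AlgebraicClosure K) (c : K) ∧ c - 1 ∈ 𝓂[K] ^ r

theorem congrOne_one (r : ℕ) : CongrOne K r 1 := ⟨1, by simp, by simp⟩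

theorem CongrOne.mul {r : ℕ} {z w : AlgebraicClosure K} (hz : CongrOne K r z)
    (hw : CongrOne K r w) : CongrOne K r (z * w) := by
  obtain ⟨c, rfl, hc⟩ := hz
  obtain ⟨e, rfl, he⟩ := hw
  refine ⟨c * e, by simp, ?_⟩
  have : c * e - 1 = c * (e - 1) + (c - 1) := by ring
  rw [this]
  exact Ideal.add_mem _ (Ideal.mul_mem_left _ _ he) hc

open scoped NormedField Valued in
theorem CongrOne.inv {r : ℕ} (hr : r ≠ 0) {z : AlgebraicClosure K} (hz : CongrOne K r z) :
    spectralNorm K (AlgebraicClosure K) z = 1 ∧ CongrOne K r z⁻¹ := by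
  obtain ⟨c, rfl, hc⟩ := hz
  have hu : IsUnit c := by
    by_contra h
    have h1 : c ∈ 𝓂[K] := (IsLocalRing.mem_maximalIdeal c).2 h
    have h2 := Ideal.sub_mem _ h1 (Ideal.pow_le_self hr hc)
    rw [sub_sub_cancel] at h2
    exact (Ideal.ne_top_iff_one _).1 (IsLocalRing.maximalIdeal.isMaximal _).ne_top h2
  refine ⟨?_, ?_⟩
  · rw [spectralNorm_extends]
    exact Valued.integer.isUnit_iff_norm_eq_one.1 hu
  · obtain ⟨u, rfl⟩ := hu
    refine ⟨(u⁻¹ : 𝒪[K]ˣ), ?_, ?_⟩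
    · rw [← map_inv₀]
      congr 1
      refine inv_eq_of_mul_eq_one_right ?_
      exact_mod_cast congrArg (Subtype.val : 𝒪[K] → K) u.mul_inv
    · have : ((u⁻¹ : 𝒪[K]ˣ) : 𝒪[K]) - 1 = -((u⁻¹ : 𝒪[K]ˣ) : 𝒪[K]) * (u - 1) := by
        rw [mul_sub, neg_mul, Units.inv_mul]; ring
      rw [this]
      exact Ideal.mul_mem_left _ _ hc

/-- Reduction of matrices over `O_D` modulo `m_D ^ m`. -/
def redMat (m : ℕ) : Matrix (Fin 2) (Fin 2) (intD K D) →+* Matrix (Fin 2) (Fin 2) (Quo K D m) :=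
  (Ideal.Quotient.mk (maxD K D ^ m)).mapMatrix

/-- A matrix over `O_D`, seen over `D`. -/
def inclMat : Matrix (Fin 2) (Fin 2) (intD K D) →+* Matrix (Fin 2) (Fin 2) D :=
  (intD K D).subtype.mapMatrix

theorem inclMat_injective : Function.Injective (inclMat K D) := fun g h hgh => by
  ext i j
  exact congrFun (congrFun hgh i) j

theorem exists_inclMat {g : Matrix (Fin 2) (Fin 2) D} (hg : ValGE K g (levelMat 0)) :
    ∃ h, inclMat K D h = g := by
  refine ⟨fun i j => ⟨g i j, ?_⟩, rfl⟩
  have := hg i j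
  change 0 ≤ val K (g i j)
  fin_cases i <;> fin_cases j <;> simpa [levelMat] using this

theorem valGE_inclMat (g : Matrix (Fin 2) (Fin 2) (intD K D)) :
    ValGE K (inclMat K D g) (levelMat 0) := by
  intro i j
  have h : (levelMat 0 i j : EReal) = 0 := by
    fin_cases i <;> fin_cases j <;> simp [levelMat]
  rw [h]
  exact (g i j).2

/-- The group `SL_2(O_D / m_D ^ (rd))`, where `d` is the degree of `D`. It consists of the matrices
over `O_D / m_D ^ (rd)` whose reduced norm, which is well defined in `O_K / m_K ^ r`, is `1`: a lift
`g` of the matrix to `O_D` satisfies `Nrd g ≡ 1` modulo `m_K ^ r`. -/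
def localSL2 (r : ℕ) : Subgroup (GL (Fin 2) (Quo K D (r * degree K D))) where
  carrier := {z | ∃ g : Matrix (Fin 2) (Fin 2) (intD K D),
    redMat K D _ g = (z : Matrix (Fin 2) (Fin 2) (Quo K D (r * degree K D))) ∧
      CongrOne K r (nrd K D 2 (inclMat K D g))}
  one_mem' := ⟨1, by rw [map_one, Units.val_one], by
    rw [map_one, map_one]; exact congrOne_one K r⟩
  mul_mem' := by
    rintro z w ⟨g, hg, hg'⟩ ⟨h, hh, hh'⟩
    refine ⟨g * h, by rw [map_mul, hg, hh, Units.val_mul], ?_⟩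
    rw [map_mul, map_mul]
    exact hg'.mul K hh'
  inv_mem' := by
    rintro z ⟨g, hg, hg'⟩
    rcases Nat.eq_zero_or_pos r with rfl | hr
    · refine ⟨1, ?_, by rw [map_one, map_one]; exact congrOne_one K 0⟩
      have : Subsingleton (Quo K D (0 * degree K D)) := by
        rw [Ideal.Quotient.subsingleton_iff, zero_mul, Submodule.pow_zero, Ideal.one_eq_top]
      exact Subsingleton.elim _ _
    · obtain ⟨hn, hinv⟩ := hg'.inv K hr.ne'
      obtain ⟨h, hgh, hhg, hv⟩ := exists_inv K (valGE_inclMat K D g) hn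
      obtain ⟨h, rfl⟩ := exists_inclMat K D hv
      have hgh' : g * h = 1 := inclMat_injective K D (by rw [map_mul, hgh, map_one])
      refine ⟨h, ?_, ?_⟩
      · symm
        apply Units.inv_eq_of_mul_eq_one_right
        rw [← hg, ← map_mul, hgh', map_one]
      · have : nrd K D 2 (inclMat K D h) = (nrd K D 2 (inclMat K D g))⁻¹ := by
          refine eq_inv_of_mul_eq_one_right ?_
          rw [← map_mul, hgh, map_one]
        rwa [this]

theorem val_mem_intD {g : SL2 K D} (hg : g ∈ P K D 0) (i j : Fin 2) :
    ((g : GL (Fin 2) D) : Matrix (Fin 2) (Fin 2) D) i j ∈ intD K D := by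
  obtain ⟨h, hh⟩ := exists_inclMat K D hg
  rw [← hh]
  exact (h i j).2

/-- The elements of `P_0 = SL_2(O_D)` as matrices over `O_D`. -/
def intMat (g : P K D 0) : Matrix (Fin 2) (Fin 2) (intD K D) :=
  fun i j => ⟨(((g : SL2 K D) : GL (Fin 2) D) : Matrix (Fin 2) (Fin 2) D) i j,
    val_mem_intD K D g.2 i j⟩

theorem inclMat_intMat (g : P K D 0) : inclMat K D (intMat K D g) =
    (((g : SL2 K D) : GL (Fin 2) D) : Matrix (Fin 2) (Fin 2) D) := rfl

theorem intMat_one : intMat K D 1 = 1 :=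
  inclMat_injective K D (by rw [inclMat_intMat, map_one]; rfl)

theorem intMat_mul (g h : P K D 0) : intMat K D (g * h) = intMat K D g * intMat K D h :=
  inclMat_injective K D (by rw [map_mul]; rfl)

/-- The homomorphism `p_{rd} : P_0 → SL_2(O_D / m_D ^ (rd))` reducing the entries. -/
def reduction (r : ℕ) : P K D 0 →* localSL2 K D r where
  toFun g := ⟨⟨redMat K D _ (intMat K D g), redMat K D _ (intMat K D g⁻¹),
      by rw [← map_mul, ← intMat_mul, mul_inv_cancel, intMat_one, map_one],
      by rw [← map_mul, ← intMat_mul, inv_mul_cancel, intMat_one, map_one]⟩,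
    intMat K D g, rfl, by
      have h1 : nrd K D 2 (inclMat K D (intMat K D g)) = 1 :=
        congrArg Units.val (MonoidHom.mem_ker.1 (g : SL2 K D).2)
      rw [h1]; exact congrOne_one K r⟩
  map_one' := Subtype.ext (Units.ext (by
    change redMat K D _ (intMat K D 1) = 1
    rw [intMat_one, map_one]))
  map_mul' g h := Subtype.ext (Units.ext (by
    change redMat K D _ (intMat K D (g * h)) = redMat K D _ (intMat K D g) * redMat K D _ _
    rw [intMat_mul, map_mul]))

variable {D}

/-- The matrix over `O_D / m_D ^ (rd)` underlying an element of the local group. -/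
abbrev locMat {r : ℕ} (g : localSL2 K D r) : Matrix (Fin 2) (Fin 2) (Quo K D (r * degree K D)) :=
  ((g : GL (Fin 2) (Quo K D (r * degree K D))) : Matrix (Fin 2) (Fin 2) _)

variable (D)

/-- The local stabiliser `P_x^{0,rd}`, the elements `g` with `ω(g) ≥ (0, -x; x, 0)`. For `x = 0` it
is the whole group `SL_2(O_D / m_D ^ (rd))`. -/
def localP (r : ℕ) (x : ℝ) : Set (localSL2 K D r) :=
  {g | ∀ i j, (levelMat x i j : EReal) ≤ quoVal K (locMat K g i j)}

/-- The subset `H^{0,rd}` of matrices `(x, 0; 0, x⁻¹)` with `ω(x) = 0`. -/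
def localH (r : ℕ) : Set (localSL2 K D r) :=
  {n | ∃ x : (Quo K D (r * degree K D))ˣ, quoVal K (x : Quo K D (r * degree K D)) = 0 ∧
    locMat K n = !![(x : Quo K D (r * degree K D)), 0; 0, ((x⁻¹ : (Quo K D _)ˣ) : Quo K D _)]}

/-- The subset `M^{0,rd}` of matrices `(0, -x; x⁻¹, 0)` with `ω(x) = 0`. -/
def localM (r : ℕ) : Set (localSL2 K D r) :=
  {n | ∃ x : (Quo K D (r * degree K D))ˣ, quoVal K (x : Quo K D (r * degree K D)) = 0 ∧
    locMat K n = !![0, -(x : Quo K D (r * degree K D)); ((x⁻¹ : (Quo K D _)ˣ) : Quo K D _), 0]}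

/-- `N^{0,rd} = H^{0,rd} ⊔ M^{0,rd}`. -/
def localN (r : ℕ) : Set (localSL2 K D r) := localH K D r ∪ localM K D r

variable {D}

open Classical in
/-- The affine action of `N^{0,rd}` on `ℝ`: trivial on `H^{0,rd}`, the reflection through `0` on
`M^{0,rd}`. It is only used on `N^{0,rd}`. -/
def localNu {r : ℕ} (n : localSL2 K D r) : ℝ ≃ᵃ[ℝ] ℝ :=
  if n ∈ localH K D r then AffineEquiv.refl ℝ ℝ else AffineEquiv.pointReflection ℝ (0 : ℝ)

/-- The interval `[-ω(π ^ (rd)), ω(π ^ (rd))]`. -/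
def interval (π : intD K D) (r : ℕ) : Set ℝ :=
  Set.Icc (-realVal K ((π : D) ^ (r * degree K D))) (realVal K ((π : D) ^ (r * degree K D)))

/-- The relation `(g, x) ∼_{0,rd} (h, y)` on `P_0^{0,rd} × [-ω(π ^ (rd)), ω(π ^ (rd))]`. -/
def LocalRel (π : intD K D) (r : ℕ) (p q : localSL2 K D r × interval K π r) : Prop :=
  ∃ n ∈ localN K D r, localNu K n p.2 = q.2 ∧ p.1⁻¹ * q.1 * n ∈ localP K D r p.2

/-- The local Bruhat–Tits tree of radius `rd` around `0`: the quotient by `LocalRel`. -/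
def LocalTree (π : intD K D) (r : ℕ) : Type _ := Quot (LocalRel K π r)

/-- The class `[(g, x)]^{0,rd}` in the local tree. -/
def LocalTree.mk (π : intD K D) (r : ℕ) (g : localSL2 K D r) (x : interval K π r) :
    LocalTree K π r := Quot.mk _ (g, x)

/-- `P_0^{0,rd}` acts on the local tree by multiplication on the first component. -/
instance LocalTree.mulAction (π : intD K D) (r : ℕ) :
    MulAction (localSL2 K D r) (LocalTree K π r) where
  smul k := Quot.map (fun p => (k * p.1, p.2)) (by
    rintro p q ⟨n, hn, h1, h2⟩
    refine ⟨n, hn, h1, ?_⟩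
    have : (k * p.1)⁻¹ * (k * q.1) * n = p.1⁻¹ * q.1 * n := by group
    rwa [this])
  one_smul p := by
    induction p using Quot.ind with
    | _ p => exact congrArg (Quot.mk _) (Prod.ext (one_mul _) rfl)
  mul_smul k l p := by
    induction p using Quot.ind with
    | _ p => exact congrArg (Quot.mk _) (Prod.ext (mul_assoc _ _ _) rfl)

end Local

end

end BTTree

/-! Everything comes down to comparing two equivalence relations on pairs `(g, x)` with `g` in
`P_0`. Among such pairs the tree identifies `(g, x)` and `(h, y)` only if `y = x` and `g⁻¹h ∈ P_x`,
or `y = -x` and `g⁻¹hw ∈ P_x`, where `w` is the Weyl element (`treeRel_integral_iff`). The reason is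
that a matrix in `SL_2(O_D)` has a diagonal consisting of two units (`unit_entries`), and this pins
down the absolute values of the entries of the monomial matrix. Hence `|x|` is an invariant of the
point, and it measures the distance to the base vertex; this gives the description of the ball
(`mem_ball_iff`).

For `|x| ≤ ω(π^(rd))`, membership in `P_x` depends only on the entries modulo `m_D^(rd)`
(`reduction_mem_localP_iff`), so the local relation is given by the same two conditions
(`localRel_iff`). One equivalence, `localTree_mk_eq_iff`, then yields both well-definedness and
injectivity.

Surjectivity, and the lifting of local monomial matrices, need `SL_2(O_D) → SL_2(O_D/m_D^(rd))` to
be onto (`reduction_surjective`). A lift has reduced norm in `1 + m_K^r`, which has to be corrected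
by an element of `1 + m_D^(rd)`. Counting dimensions gives `e = f = d`, and a normal basis of the
residue extension provides `w ∈ O_D` whose minimal polynomial has degree `d` and unit trace
(`exists_unit_trace`). Then `Nrd(1 - tw) = 1 + ut + O(t²)` with `u` a unit, and a contraction
argument solves `Nrd(1 - tw) = c` for `c ∈ 1 + m_K^r` (`exists_det_splitting_eq`). -/

namespace BTTree

noncomputable section

/-! ### The tree relation, integral representatives and distances -/

section TreeRelation

set_option linter.unusedSectionVars false

variable {K : Type*} {D : Type*} [NontriviallyNormedField K] [IsUltrametricDist K]
  [CompleteSpace K] [DivisionRing D] [Algebra K D] [FiniteDimensional K D]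
  [Algebra.IsCentral K D]

/-- The matrix over `D` underlying an element of `SL_2(D)`. -/
abbrev mat (g : SL2 K D) : Matrix (Fin 2) (Fin 2) D := ((g : GL (Fin 2) D) : Matrix (Fin 2) (Fin 2) D)

theorem mat_mul (g h : SL2 K D) : mat (g * h) = mat g * mat h := rfl

theorem mat_one : mat (1 : SL2 K D) = 1 := rfl

theorem mat_inv_eq {n : SL2 K D} {m : Matrix (Fin 2) (Fin 2) D} (h : mat n * m = 1) :
    mat n⁻¹ = m := by
  have h1 : mat n⁻¹ * mat n = 1 := by rw [← mat_mul, inv_mul_cancel, mat_one]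
  rw [← mul_one (mat n⁻¹), ← h, ← mul_assoc, h1, one_mul]

theorem nrd_mat (g : SL2 K D) : nrd K D 2 (mat g) = 1 :=
  congrArg Units.val (MonoidHom.mem_ker.1 g.2)

theorem mem_P_iff {g : SL2 K D} {x : ℝ} : g ∈ P K D x ↔
    absD K (mat g 0 0) ≤ 1 ∧ absD K (mat g 0 1) ≤ Real.exp x ∧
      absD K (mat g 1 0) ≤ (Real.exp x)⁻¹ ∧ absD K (mat g 1 1) ≤ 1 :=
  valGE_levelMat_iff K _ x

theorem mem_P_zero_iff {g : SL2 K D} : g ∈ P K D 0 ↔ ∀ i j, absD K (mat g i j) ≤ 1 := by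
  rw [mem_P_iff]
  simp [Fin.forall_fin_two, and_assoc]

/-- A matrix of reduced norm `1` is invertible, so it is an element of `SL_2(D)`. -/
theorem exists_mat_eq {m m' : Matrix (Fin 2) (Fin 2) D} (h1 : m * m' = 1) (h2 : m' * m = 1)
    (hn : nrd K D 2 m = 1) : ∃ g : SL2 K D, mat g = m :=
  ⟨⟨⟨m, m', h1, h2⟩, MonoidHom.mem_ker.2 (Units.ext hn)⟩, rfl⟩

theorem absD_mul_of_spectralNorm {u v : D} (h : spectralNorm K (AlgebraicClosure K)
    ((splitting K D u).det * (splitting K D v).det) = 1) : absD K u * absD K v = 1 := by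
  rw [spectralNorm_mul', ← absD_pow, ← absD_pow, ← mul_pow] at h
  exact (pow_eq_one_iff_of_nonneg (mul_nonneg (absD_nonneg K u) (absD_nonneg K v))
    (degree_pos K).ne').1 h

theorem absD_det_schur (m : SL2 K D) (ha : mat m 0 0 ≠ 0) :
    absD K (mat m 0 0) * absD K (mat m 1 1 - mat m 1 0 * (mat m 0 0)⁻¹ * mat m 0 1) = 1 := by
  have h := nrd_mat m
  rw [Matrix.eta_fin_two (mat m), nrd_schur K _ _ _ ha] at h
  refine absD_mul_of_spectralNorm ?_
  rw [h, spectralNorm_one]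

theorem absD_diag {m : SL2 K D} {a b : D} (h : mat m = !![a, 0; 0, b]) :
    absD K a * absD K b = 1 := by
  have h1 := nrd_mat m
  rw [h, nrd_lower] at h1
  exact absD_mul_of_spectralNorm (by rw [h1, spectralNorm_one])

theorem diag_inv_mem (a : D) (ha : a ≠ 0) : ∃ g : SL2 K D, mat g = !![a, 0; 0, a⁻¹] := by
  refine exists_mat_eq (m' := !![a⁻¹, 0; 0, a]) ?_ ?_ ?_
  · simp [Matrix.one_fin_two, ha]
  · simp [Matrix.one_fin_two, ha]
  · rw [nrd_lower, ← Matrix.det_mul, ← map_mul, mul_inv_cancel₀ ha, map_one, Matrix.det_one]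

theorem exists_weyl : ∃ w : SL2 K D, mat w = !![0, -1; 1, 0] := by
  refine exists_mat_eq (m' := !![0, 1; -1, 0]) ?_ ?_ ?_
  · simp [Matrix.one_fin_two]
  · simp [Matrix.one_fin_two]
  · have h : (!![0, -1; 1, 0] : Matrix (Fin 2) (Fin 2) D) =
        !![1, -1; 0, 1] * (!![1, 0; 1, 1] * !![1, -1; 0, 1]) := by simp
    have h1 : nrd K D 2 !![1, -1; 0, 1] = 1 := by
      rw [nrd_eq, map_zero, Matrix.det_fromBlocks_zero₂₁]; simp
    rw [h, map_mul, map_mul, nrd_lower, h1]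
    simp

/-- The matrix `(0, -1; 1, 0)`. -/
def weyl : SL2 K D := exists_weyl.choose

theorem mat_weyl : mat (weyl : SL2 K D) = !![0, -1; 1, 0] := exists_weyl.choose_spec

theorem weyl_mem : (weyl : SL2 K D) ∈ P K D 0 := by
  rw [mem_P_iff, mat_weyl]
  simp [absD_zero, absD_one, absD_neg]

theorem absD_antidiag {m : SL2 K D} {b c : D} (h : mat m = !![0, b; c, 0]) :
    absD K b * absD K c = 1 := by
  have h1 : mat (m * weyl) = !![b, 0; 0, -c] := by
    rw [mat_mul, h, mat_weyl]; simp
  have h2 := absD_diag h1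
  rwa [absD_neg] at h2

/-- `n` is a monomial matrix whose affine action on the apartment sends `x` to `y`. -/
def IsMon (n : SL2 K D) (x y : ℝ) : Prop :=
  (∃ a b, mat n = !![a, 0; 0, b] ∧ y = x + 2 * Real.log (absD K a)) ∨
    ∃ b c, mat n = !![0, b; c, 0] ∧ y = -x + 2 * Real.log (absD K b)

theorem nu_diag {n : SL2 K D} (hn : n ∈ T K D) (x : ℝ) :
    nu K n x = x + 2 * Real.log (absD K (mat n 0 0)) := by
  rw [nu, if_pos hn, AffineEquiv.constVAdd_apply, vadd_eq_add, realVal]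
  ring

theorem nu_antidiag {n : SL2 K D} (hn : n ∈ M K D) (x : ℝ) :
    nu K n x = -x + 2 * Real.log (absD K (mat n 0 1)) := by
  have hT : n ∉ T K D := by
    rintro ⟨a, ha, h⟩
    obtain ⟨b, hb, h'⟩ := hn
    have := congrFun (congrFun (h.symm.trans h') 0) 0
    exact ha (by simpa using this)
  rw [nu, if_neg hT, AffineEquiv.pointReflection_apply, vsub_eq_sub, vadd_eq_add, realVal, absD_neg]
  ring

theorem mem_P_of_diag {n : SL2 K D} {a b : D} (h : mat n = !![a, 0; 0, b]) (ha : absD K a = 1)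
    (x : ℝ) : n ∈ P K D x := by
  have hb := absD_diag h
  rw [ha, one_mul] at hb
  rw [mem_P_iff, h]
  simp [absD_zero, ha, hb, Real.exp_nonneg]

/-- For noncommutative `D` the set `T` is not closed under multiplication, so symmetry and
transitivity are proved for all monomial matrices of reduced norm `1`. Such a matrix differs from an
element of `N` by a right factor that is diagonal with entries of absolute value `1`, and this
factor lies in every `P_x`. -/
theorem treeRel_iff {p q : SL2 K D × ℝ} :
    TreeRel K D p q ↔ ∃ n, IsMon n p.2 q.2 ∧ p.1⁻¹ * q.1 * n ∈ P K D p.2 := by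
  constructor
  · rintro ⟨n, hn, h1, h2⟩
    refine ⟨n, ?_, h2⟩
    rcases hn with hn | hn
    · rw [nu_diag hn] at h1
      obtain ⟨a, ha, h⟩ := hn
      exact Or.inl ⟨a, _, h, by rw [h1, show mat n = _ from h]; simp⟩
    · rw [nu_antidiag hn] at h1
      obtain ⟨a, ha, h⟩ := hn
      exact Or.inr ⟨-a, _, h, by rw [h1, show mat n = _ from h]; simp⟩
  · have hne : ∀ {u v : D}, absD K u * absD K v = 1 → u ≠ 0 ∧ v ≠ 0 := by
      intro u v h
      constructor <;> rintro rfl <;> simp [absD_zero] at h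
    rintro ⟨n, ⟨a, b, h, h1⟩ | ⟨b, c, h, h1⟩, h2⟩
    · have hab := absD_diag h
      obtain ⟨ha, hb⟩ := hne hab
      obtain ⟨t, ht⟩ := diag_inv_mem (K := K) a ha
      have htT : t ∈ T K D := ⟨a, ha, ht⟩
      obtain ⟨s, hs⟩ : ∃ s : SL2 K D, s = n⁻¹ * t := ⟨_, rfl⟩
      have hs' : mat s = !![1, 0; 0, b⁻¹ * a⁻¹] := by
        have h3 : mat n * mat s = mat t := by rw [← mat_mul, hs, mul_inv_cancel_left]
        have h4 : !![a⁻¹, 0; 0, b⁻¹] * mat n = 1 := by rw [h]; simp [ha, hb, Matrix.one_fin_two]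
        calc mat s = !![a⁻¹, 0; 0, b⁻¹] * (mat n * mat s) := by rw [← mul_assoc, h4, one_mul]
          _ = _ := by rw [h3, ht]; simp [ha]
      refine ⟨t, Or.inl htT, ?_, ?_⟩
      · rw [nu_diag htT, h1, ht]; simp
      · have := (P K D p.2).mul_mem h2 (mem_P_of_diag hs' (absD_one K) p.2)
        rwa [hs, mul_assoc, mul_inv_cancel_left] at this
    · have hab := absD_antidiag h
      obtain ⟨hb, hc⟩ := hne hab
      obtain ⟨t', ht'⟩ := diag_inv_mem (K := K) (-b) (neg_ne_zero.2 hb)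
      obtain ⟨t, ht⟩ : ∃ t : SL2 K D, t = t' * weyl := ⟨_, rfl⟩
      have ht : mat t = !![0, b; (-b)⁻¹, 0] := by
        rw [ht, mat_mul, ht', mat_weyl]; simp
      have htM : t ∈ M K D := ⟨-b, neg_ne_zero.2 hb, by rw [neg_neg]; exact ht⟩
      obtain ⟨s, hs⟩ : ∃ s : SL2 K D, s = n⁻¹ * t := ⟨_, rfl⟩
      have hs' : mat s = !![c⁻¹ * (-b)⁻¹, 0; 0, 1] := by
        have h3 : mat n * mat s = mat t := by rw [← mat_mul, hs, mul_inv_cancel_left]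
        have h4 : !![0, c⁻¹; b⁻¹, 0] * mat n = 1 := by rw [h]; simp [hc, hb, Matrix.one_fin_two]
        calc mat s = !![0, c⁻¹; b⁻¹, 0] * (mat n * mat s) := by rw [← mul_assoc, h4, one_mul]
          _ = _ := by rw [h3, ht]; simp [hb]
      refine ⟨t, Or.inr htM, ?_, ?_⟩
      · rw [nu_antidiag htM, h1, ht]; simp
      · have h5 := absD_diag hs'
        rw [absD_one, mul_one] at h5
        have := (P K D p.2).mul_mem h2 (mem_P_of_diag hs' h5 p.2)
        rwa [hs, mul_assoc, mul_inv_cancel_left] at this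

/-- Conjugation by a diagonal matrix translates the stabilisers. -/
theorem conj_diag_mem {n k : SL2 K D} {a b : D} (h : mat n = !![a, 0; 0, b]) {x : ℝ}
    (hk : k ∈ P K D x) : n * k * n⁻¹ ∈ P K D (x + 2 * Real.log (absD K a)) := by
  have hab := absD_diag h
  have ha : a ≠ 0 := by rintro rfl; simp [absD_zero] at hab
  have hb : b ≠ 0 := by rintro rfl; simp [absD_zero] at hab
  have hinv : mat n⁻¹ = !![a⁻¹, 0; 0, b⁻¹] := by
    refine mat_inv_eq ?_
    rw [h]; simp [ha, hb, Matrix.one_fin_two]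
  rw [mem_P_iff] at hk ⊢
  rw [mat_mul, mat_mul, h, hinv]
  generalize mat k = m at *
  obtain ⟨h00, h01, h10, h11⟩ := hk
  have hA := absD_pos K ha
  have hb' : absD K b = (absD K a)⁻¹ := eq_inv_of_mul_eq_one_right hab
  have hX := Real.exp_pos x
  have he : Real.exp (x + 2 * Real.log (absD K a)) = Real.exp x * absD K a ^ 2 := by
    rw [Real.exp_add, two_mul, Real.exp_add, Real.exp_log hA, sq]
  rw [Matrix.eta_fin_two m]
  simp only [Matrix.mul_fin_two, Matrix.of_apply, Matrix.cons_val', Matrix.cons_val_zero,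
    Matrix.cons_val_one, Matrix.cons_val_fin_one, zero_mul, mul_zero, add_zero, zero_add, absD_mul,
    absD_inv, hb', he, inv_inv]
  refine ⟨?_, ?_, ?_, ?_⟩
  · calc _ = absD K (m 0 0) := by field_simp
      _ ≤ 1 := h00
  · calc _ = absD K (m 0 1) * absD K a ^ 2 := by ring
      _ ≤ _ := by gcongr
  · calc _ = absD K (m 1 0) * (absD K a ^ 2)⁻¹ := by field_simp
      _ ≤ (Real.exp x)⁻¹ * (absD K a ^ 2)⁻¹ := by gcongr
      _ = _ := by rw [mul_inv]
  · calc _ = absD K (m 1 1) := by field_simp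
      _ ≤ 1 := h11

theorem conj_weyl_mem {k : SL2 K D} {x : ℝ} (hk : k ∈ P K D x) :
    weyl * k * weyl⁻¹ ∈ P K D (-x) := by
  have hinv : mat (weyl⁻¹ : SL2 K D) = !![0, 1; -1, 0] := by
    refine mat_inv_eq ?_
    rw [mat_weyl]; simp [Matrix.one_fin_two]
  rw [mem_P_iff] at hk ⊢
  rw [mat_mul, mat_mul, mat_weyl, hinv]
  generalize mat k = m at *
  obtain ⟨h00, h01, h10, h11⟩ := hk
  rw [Matrix.eta_fin_two m]
  simp [absD_neg, Real.exp_neg, *]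

/-- An antidiagonal `n` is `n * weyl⁻¹`, which is diagonal, times `weyl`; the two conjugations
compose. -/
theorem conj_antidiag_mem {n k : SL2 K D} {b c : D} (h : mat n = !![0, b; c, 0]) {x : ℝ}
    (hk : k ∈ P K D x) : n * k * n⁻¹ ∈ P K D (-x + 2 * Real.log (absD K b)) := by
  have h1 : mat (n * weyl⁻¹) = !![-b, 0; 0, c] := by
    have hm : mat (n * weyl⁻¹) * mat (weyl : SL2 K D) = mat n := by
      rw [← mat_mul, inv_mul_cancel_right]
    have hw : mat (weyl : SL2 K D) * !![0, 1; -1, 0] = 1 := by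
      rw [mat_weyl]; simp [Matrix.one_fin_two]
    rw [← mul_one (mat (n * weyl⁻¹)), ← hw, ← mul_assoc, hm, h]; simp
  have h2 := conj_diag_mem h1 (conj_weyl_mem hk)
  rw [absD_neg] at h2
  have h3 : n * weyl⁻¹ * (weyl * k * weyl⁻¹) * (n * weyl⁻¹)⁻¹ = n * k * n⁻¹ := by group
  rwa [h3] at h2

theorem IsMon.conj_mem {n k : SL2 K D} {x y : ℝ} (hn : IsMon n x y) (hk : k ∈ P K D x) :
    n * k * n⁻¹ ∈ P K D y := by
  rcases hn with ⟨a, b, h, rfl⟩ | ⟨b, c, h, rfl⟩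
  · exact conj_diag_mem h hk
  · exact conj_antidiag_mem h hk

theorem log_absD_of_mul {a b : D} (h : absD K a * absD K b = 1) :
    Real.log (absD K b) = -Real.log (absD K a) := by
  rw [eq_inv_of_mul_eq_one_right h, Real.log_inv]

theorem IsMon.inv {n : SL2 K D} {x y : ℝ} (hn : IsMon n x y) : IsMon n⁻¹ y x := by
  rcases hn with ⟨a, b, h, rfl⟩ | ⟨b, c, h, rfl⟩
  · have hab := absD_diag h
    have ha : a ≠ 0 := by rintro rfl; simp [absD_zero] at hab
    have hb : b ≠ 0 := by rintro rfl; simp [absD_zero] at hab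
    refine Or.inl ⟨a⁻¹, b⁻¹, mat_inv_eq ?_, ?_⟩
    · rw [h]; simp [ha, hb, Matrix.one_fin_two]
    · rw [absD_inv, Real.log_inv]; ring
  · have hab := absD_antidiag h
    have hb : b ≠ 0 := by rintro rfl; simp [absD_zero] at hab
    have hc : c ≠ 0 := by rintro rfl; simp [absD_zero] at hab
    refine Or.inr ⟨c⁻¹, b⁻¹, mat_inv_eq ?_, ?_⟩
    · rw [h]; simp [hb, hc, Matrix.one_fin_two]
    · rw [absD_inv, Real.log_inv, log_absD_of_mul hab]; ring

theorem IsMon.mul {m n : SL2 K D} {x y z : ℝ} (hn : IsMon n x y) (hm : IsMon m y z) :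
    IsMon (m * n) x z := by
  have hlog : ∀ {u v s t : D}, absD K u * absD K s = 1 → absD K v * absD K t = 1 →
      Real.log (absD K (u * v)) = Real.log (absD K u) + Real.log (absD K v) := by
    intro u v s t hu hv
    rw [absD_mul, Real.log_mul (left_ne_zero_of_mul_eq_one hu) (left_ne_zero_of_mul_eq_one hv)]
  rcases hn with ⟨a, b, h, rfl⟩ | ⟨a, b, h, rfl⟩ <;>
    rcases hm with ⟨a', b', h', rfl⟩ | ⟨a', b', h', rfl⟩
  · refine Or.inl ⟨a' * a, b' * b, by rw [mat_mul, h, h']; simp, ?_⟩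
    rw [hlog (absD_diag h') (absD_diag h)]; ring
  · have h1 := absD_diag h
    refine Or.inr ⟨a' * b, b' * a, by rw [mat_mul, h, h']; simp, ?_⟩
    rw [hlog (absD_antidiag h') ((mul_comm _ _).trans h1), log_absD_of_mul h1]; ring
  · refine Or.inr ⟨a' * a, b' * b, by rw [mat_mul, h, h']; simp, ?_⟩
    rw [hlog (absD_diag h') (absD_antidiag h)]; ring
  · have h1 := absD_antidiag h
    refine Or.inl ⟨a' * b, b' * a, by rw [mat_mul, h, h']; simp, ?_⟩
    rw [hlog (absD_antidiag h') ((mul_comm _ _).trans h1), log_absD_of_mul h1]; ring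

/-- Symmetry and transitivity rest on `n P_x n⁻¹ ⊆ P_y` for `n` carrying `x` to `y`. Since `Tree` is
a bare `Quot`, this is what turns equality of points into the relation itself. -/
theorem treeRel_equivalence : Equivalence (TreeRel K D) where
  refl p := treeRel_iff.2 ⟨1, Or.inl ⟨1, 1, by rw [mat_one, Matrix.one_fin_two], by
    rw [absD_one, Real.log_one]; ring⟩, by simp [one_mem]⟩
  symm {p q} h := by
    obtain ⟨n, hn, hk⟩ := treeRel_iff.1 h
    refine treeRel_iff.2 ⟨n⁻¹, hn.inv, ?_⟩
    have := hn.conj_mem (inv_mem hk)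
    have e : n * (p.1⁻¹ * q.1 * n)⁻¹ * n⁻¹ = q.1⁻¹ * p.1 * n⁻¹ := by group
    rwa [e] at this
  trans {p q s} h h' := by
    obtain ⟨n, hn, hk⟩ := treeRel_iff.1 h
    obtain ⟨m, hm, hl⟩ := treeRel_iff.1 h'
    refine treeRel_iff.2 ⟨m * n, hn.mul hm, ?_⟩
    have := mul_mem hk (hn.inv.conj_mem hl)
    have e : p.1⁻¹ * q.1 * n * (n⁻¹ * (q.1⁻¹ * s.1 * m) * n⁻¹⁻¹) = p.1⁻¹ * s.1 * (m * n) := by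
      group
    rwa [e] at this

theorem Tree.mk_eq_iff {g h : SL2 K D} {x y : ℝ} :
    Tree.mk K g x = Tree.mk K h y ↔ TreeRel K D (g, x) (h, y) :=
  treeRel_equivalence.quot_mk_eq_iff _ _

/-- In a matrix of `SL_2(O_D)`, the two entries of one of the diagonals are units. -/
theorem unit_entries {k : SL2 K D} (hk : k ∈ P K D 0) :
    (absD K (mat k 0 0) = 1 ∧ absD K (mat k 1 1) = 1) ∨
      (absD K (mat k 0 1) = 1 ∧ absD K (mat k 1 0) = 1) := by
  have hle := mem_P_zero_iff.1 hk
  have hN := absD_nonneg K (D := D)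
  have key : ∀ {s t : ℝ}, 0 ≤ s → 0 ≤ t → s ≤ 1 → t ≤ 1 → 1 ≤ s * t → s = 1 ∧ t = 1 := by
    intro s t h1 h2 h3 h4 h5
    constructor <;> nlinarith
  by_cases ha : mat k 0 0 = 0
  · right
    have : mat k = !![0, mat k 0 1; mat k 1 0, mat k 1 1] := by
      conv_lhs => rw [Matrix.eta_fin_two (mat k), ha]
    -- With a vanishing corner, `weyl` makes the matrix block triangular, so the reduced norm is the
    -- product of those of the two antidiagonal entries, up to sign.
    have h1 : mat (weyl * k) = !![-mat k 1 0, -mat k 1 1; 0, mat k 0 1] := by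
      rw [mat_mul, mat_weyl, this]; simp
    have h2 := nrd_mat (weyl * k)
    rw [h1, nrd_eq, map_zero, Matrix.det_fromBlocks_zero₂₁] at h2
    have h3 := absD_mul_of_spectralNorm (K := K) (by rw [h2, spectralNorm_one])
    rw [absD_neg] at h3
    exact (key (hN _) (hN _) (hle _ _) (hle _ _) h3.ge).symm
  · have h1 := absD_det_schur k ha
    have hA := absD_pos K ha
    -- The Schur complement has absolute value `1/|a|`. By the ultrametric inequality it is bounded
    -- by `|e|` or by `|c||b|/|a|`, so one of the products `|a||e|`, `|c||b|` is at least `1`.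
    have h2 := absD_sub_le K (mat k 1 1) (mat k 1 0 * (mat k 0 0)⁻¹ * mat k 0 1)
    rw [absD_mul, absD_mul, absD_inv] at h2
    rcases le_max_iff.1 h2 with h2 | h2
    · left
      refine key (hN _) (hN _) (hle _ _) (hle _ _) ?_
      rw [← h1]; gcongr
    · right
      refine key (hN _) (hN _) (hle _ _) (hle _ _) ?_
      rw [← h1]
      refine (mul_le_mul_of_nonneg_left h2 hA.le).trans (le_of_eq ?_)
      field_simp

theorem mem_P_of_weyl {k : SL2 K D} {x : ℝ} : k * weyl ∈ P K D x ↔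
    absD K (mat k 0 1) ≤ 1 ∧ absD K (mat k 0 0) ≤ Real.exp x ∧
      absD K (mat k 1 1) ≤ (Real.exp x)⁻¹ ∧ absD K (mat k 1 0) ≤ 1 := by
  rw [mem_P_iff, mat_mul, mat_weyl]
  generalize mat k = m
  rw [Matrix.eta_fin_two m]
  simp [absD_neg]

/-- Equivalence of points whose first components lie in `SL_2(O_D)`. -/
theorem treeRel_integral_iff {g h : SL2 K D} (hg : g ∈ P K D 0) (hh : h ∈ P K D 0) {x y : ℝ} :
    TreeRel K D (g, x) (h, y) ↔
      (y = x ∧ g⁻¹ * h ∈ P K D x) ∨ (y = -x ∧ g⁻¹ * h * weyl ∈ P K D x) := by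
  rw [treeRel_iff]
  constructor
  · rintro ⟨n, hn, hk⟩
    simp only at hn hk
    have hX := Real.exp_pos x
    have h0 := mul_mem (inv_mem hg) hh
    have hu := unit_entries h0
    have hle := mem_P_zero_iff.1 h0
    rw [mem_P_of_weyl, mem_P_iff]
    rw [mem_P_iff, mat_mul] at hk
    generalize mat (g⁻¹ * h) = k at *
    -- Four cases: the shape of `n` against the position of the units of `g⁻¹h`. When the two shapes
    -- agree, the entries of `n` have absolute value `1`. When they differ, the bounds force the
    -- value `exp(±x)`, and the translation or reflection by that amount again gives `y = -x` or `y
    -- = x`.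
    rcases hn with ⟨a, b, hab, hy⟩ | ⟨b, c, hbc, hy⟩
    · have h1 := absD_diag hab
      rw [hab, Matrix.eta_fin_two k] at hk
      simp only [Matrix.mul_fin_two, Matrix.of_apply, Matrix.cons_val', Matrix.cons_val_zero,
        Matrix.cons_val_one, Matrix.cons_val_fin_one, mul_zero, add_zero, zero_add, absD_mul] at hk
      have ha0 : 0 < absD K a := lt_of_le_of_ne (absD_nonneg K a)
        (left_ne_zero_of_mul_eq_one h1).symm
      have hb := eq_inv_of_mul_eq_one_right h1
      rw [hb] at hk
      generalize absD K a = α at *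
      obtain ⟨k00, k01, k10, k11⟩ := hk
      rcases hu with ⟨u1, u2⟩ | ⟨u1, u2⟩
      · have : α = 1 := by
          rw [u1, one_mul] at k00
          rw [u2, one_mul, inv_le_one₀ ha0] at k11
          exact le_antisymm k00 k11
        subst this
        left
        simp only [mul_one, inv_one] at k01 k10
        exact ⟨by rw [hy, Real.log_one]; ring, hle _ _, k01, k10, hle _ _⟩
      · have : α = (Real.exp x)⁻¹ := by
          rw [u1, one_mul] at k01
          rw [u2, one_mul] at k10
          exact le_antisymm k10 (inv_le_of_inv_le₀ ha0 k01)
        subst this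
        right
        refine ⟨?_, hle _ _, ?_, ?_, hle _ _⟩
        · rw [hy, Real.log_inv, Real.log_exp]; ring
        · rwa [mul_inv_le_iff₀ hX, one_mul] at k00
        · rw [inv_inv] at k11
          rwa [← one_div, le_div_iff₀ hX]
    · have h1 := absD_antidiag hbc
      rw [hbc, Matrix.eta_fin_two k] at hk
      simp only [Matrix.mul_fin_two, Matrix.of_apply, Matrix.cons_val', Matrix.cons_val_zero,
        Matrix.cons_val_one, Matrix.cons_val_fin_one, mul_zero, add_zero, zero_add, absD_mul] at hk
      have hb0 : 0 < absD K b := lt_of_le_of_ne (absD_nonneg K b)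
        (left_ne_zero_of_mul_eq_one h1).symm
      have hc := eq_inv_of_mul_eq_one_right h1
      rw [hc] at hk
      generalize absD K b = β at *
      obtain ⟨k00, k01, k10, k11⟩ := hk
      rcases hu with ⟨u1, u2⟩ | ⟨u1, u2⟩
      · have : β = Real.exp x := by
          rw [u1, one_mul] at k01
          rw [u2, one_mul] at k10
          exact le_antisymm k01 ((inv_le_inv₀ hb0 hX).1 k10)
        subst this
        left
        refine ⟨?_, hle _ _, ?_, ?_, hle _ _⟩
        · rw [hy, Real.log_exp]; ring
        · rwa [mul_inv_le_iff₀ hX, one_mul] at k00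
        · rwa [← one_div, le_div_iff₀ hX]
      · have : β = 1 := by
          rw [u1, one_mul, inv_le_one₀ hb0] at k00
          rw [u2, one_mul] at k11
          exact le_antisymm k11 k00
        subst this
        right
        simp only [mul_one, inv_one] at k01 k10
        exact ⟨by rw [hy, Real.log_one]; ring, hle _ _, k01, k10, hle _ _⟩
  · rintro (⟨rfl, h1⟩ | ⟨rfl, h1⟩)
    · exact ⟨1, Or.inl ⟨1, 1, by rw [mat_one, Matrix.one_fin_two], by
        rw [absD_one, Real.log_one]; ring⟩, by rwa [mul_one]⟩
    · exact ⟨weyl, Or.inr ⟨-1, 1, mat_weyl, by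
        rw [absD_neg, absD_one, Real.log_one]; ring⟩, h1⟩

/-- A point at the end of a segment from the base vertex is `[(k, y)]` with `k ∈ SL_2(O_D)`. -/
theorem exists_integral_rep {g : SL2 K D} {x : ℝ} (h : Tree.mk K g x = Tree.mk K 1 0) (y : ℝ) :
    ∃ k ∈ P K D 0, ∃ z, Tree.mk K g y = Tree.mk K k z ∧ |z| = |x - y| := by
  obtain ⟨n, hn, hk⟩ := treeRel_iff.1 (Tree.mk_eq_iff.1 h.symm)
  simp only [inv_one, one_mul] at hn hk
  -- `n` acts by an isometry of the apartment taking `0` to `x`; `z` is the preimage of `y`.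
  obtain ⟨z, hz, hzy⟩ : ∃ z, IsMon n z y ∧ |z| = |x - y| := by
    rcases hn with ⟨a, b, hab, hy⟩ | ⟨b, c, hbc, hy⟩
    · refine ⟨y - 2 * Real.log (absD K a), Or.inl ⟨a, b, hab, by ring⟩, ?_⟩
      rw [hy, abs_sub_comm]
      congr 1; ring
    · refine ⟨-y + 2 * Real.log (absD K b), Or.inr ⟨b, c, hbc, by ring⟩, ?_⟩
      rw [hy]
      congr 1; ring
  refine ⟨g * n, hk, z, Tree.mk_eq_iff.2 (treeRel_equivalence.symm (treeRel_iff.2 ⟨n, hz, ?_⟩)), hzy⟩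
  have : (g * n)⁻¹ * g * n = 1 := by group
  simp only [this]
  exact one_mem _

/-- Integral representatives of one point have coordinates equal up to sign, so `|x|` is a radial
coordinate on the tree. -/
theorem abs_eq_of_mk_eq {g h : SL2 K D} (hg : g ∈ P K D 0) (hh : h ∈ P K D 0) {x y : ℝ}
    (e : Tree.mk K g x = Tree.mk K h y) : |x| = |y| := by
  rcases (treeRel_integral_iff hg hh).1 (Tree.mk_eq_iff.1 e) with ⟨rfl, -⟩ | ⟨rfl, -⟩
  · rfl
  · rw [abs_neg]

theorem mk_integral_zero {g : SL2 K D} (hg : g ∈ P K D 0) : Tree.mk K g 0 = Tree.mk K 1 0 :=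
  Tree.mk_eq_iff.2 ((treeRel_integral_iff hg (one_mem _)).2 (Or.inl ⟨rfl, by
    simpa using inv_mem hg⟩))

/-- The distance from the base vertex. -/
theorem treeDist_integral (π : intD K D) {g : SL2 K D} (hg : g ∈ P K D 0) (x : ℝ) :
    treeDist K π (Tree.mk K 1 0) (Tree.mk K g x) = ENNReal.ofReal (|x| / realVal K (π : D)) := by
  refine le_antisymm ?_ ?_
  · refine iInf_le_of_le g (iInf_le_of_le 0 (iInf_le_of_le x (iInf_le_of_le (mk_integral_zero hg)
      (iInf_le_of_le rfl ?_))))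
    rw [zero_sub, abs_neg]
  -- Every common apartment gives the same value: moving its base point to `0` yields an integral
  -- representative, whose radial coordinate is `|x|`.
  · refine le_iInf fun h => le_iInf fun s => le_iInf fun t => le_iInf fun h1 => le_iInf fun h2 => ?_
    obtain ⟨k, hk, z, hz, hzt⟩ := exists_integral_rep h1 t
    rw [← hzt, abs_eq_of_mk_eq hk hg (hz.symm.trans h2)]

/-- An infimum over no common apartment would be `⊤`, so a finite distance supplies an apartment
through the base vertex. -/
theorem exists_integral_of_treeDist (π : intD K D) {p : Tree K D}
    (h : treeDist K π (Tree.mk K 1 0) p ≠ ⊤) : ∃ g ∈ P K D 0, ∃ x, Tree.mk K g x = p := by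
  by_contra hcon
  apply h
  simp only [treeDist, iInf_eq_top]
  intro g x y h1 h2
  obtain ⟨k, hk, z, hz, -⟩ := exists_integral_rep h1 y
  exact absurd ⟨k, hk, z, hz.symm.trans h2⟩ hcon

end TreeRelation

/-! ### Minimal polynomials and the splitting -/

section MinimalPolynomials

set_option linter.unusedSectionVars false

open Polynomial

variable {K : Type*} {D : Type*} [NontriviallyNormedField K] [IsUltrametricDist K]
  [CompleteSpace K] [DivisionRing D] [Algebra K D] [FiniteDimensional K D]
  [Algebra.IsCentral K D]

theorem absD_algebraMap (c : K) : absD K (algebraMap K D c) = ‖c‖ := by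
  have h := absD_pow K (algebraMap K D c)
  rw [AlgHom.commutes, Matrix.algebraMap_eq_diagonal, Matrix.det_diagonal] at h
  simp only [Pi.algebraMap_apply, Finset.prod_const, Finset.card_univ, Fintype.card_fin] at h
  rw [← map_pow, spectralNorm_extends, norm_pow] at h
  exact (pow_left_inj₀ (absD_nonneg K _) (norm_nonneg c) (degree_pos K).ne').1 h

theorem absD_smul (c : K) (x : D) : absD K (c • x) = ‖c‖ * absD K x := by
  rw [Algebra.smul_def, absD_mul, absD_algebraMap]

theorem absD_pow' (x : D) (n : ℕ) : absD K (x ^ n) = absD K x ^ n := by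
  induction n with
  | zero => rw [pow_zero, pow_zero, absD_one]
  | succ n ih => rw [pow_succ, pow_succ, absD_mul, ih]

/-- The determinant is a product of `d` eigenvalues, all of the same spectral norm because they are
roots of the irreducible minimal polynomial. -/
theorem absD_eq_spectralValue (x : D) : absD K x = spectralValue (minpoly K x) := by
  have h1 : absD K x ^ degree K D = spectralValue (minpoly K x) ^ degree K D := by
    rw [absD_pow, Matrix.det_eq_prod_roots_charpoly, spectralNorm_multiset_prod,
      Multiset.map_congr rfl (fun l hl => spectralNorm_root K x hl), Multiset.map_const',
      Multiset.prod_replicate, IsAlgClosed.card_roots_eq_natDegree,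
      Matrix.charpoly_natDegree_eq_dim, Fintype.card_fin]
  exact (pow_left_inj₀ (absD_nonneg K x) (spectralValue_nonneg _) (degree_pos K).ne').1 h1

theorem norm_coeff_minpoly_le_one {x : D} (hx : absD K x ≤ 1) (n : ℕ) :
    ‖(minpoly K x).coeff n‖ ≤ 1 := by
  rw [absD_eq_spectralValue] at hx
  exact (spectralValue_le_one_iff (minpoly.monic (Algebra.IsIntegral.isIntegral x))).1 hx n

/-- Up to sign the constant term is the product of the conjugates, each of norm `|x|`. Applied to
`π`, this bounds the ramification index by the degree. -/
theorem norm_coeff_zero_minpoly (x : D) :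
    ‖(minpoly K x).coeff 0‖ = absD K x ^ (minpoly K x).natDegree := by
  have hx : IsIntegral K x := Algebra.IsIntegral.isIntegral x
  set p := (minpoly K x).map (algebraMap K (AlgebraicClosure K)) with hp
  have hm : p.Monic := (minpoly.monic hx).map _
  have hs : p.Splits := IsAlgClosed.splits p
  have hroot : ∀ l ∈ p.roots, spectralNorm K (AlgebraicClosure K) l = absD K x := by
    intro l hl
    rw [absD_eq_spectralValue, spectralNorm, ← minpoly.eq_of_irreducible_of_monic
      (minpoly.irreducible hx) _ (minpoly.monic hx)]
    rw [← eval_map_algebraMap]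
    exact isRoot_of_mem_roots hl
  have h0 : algebraMap K (AlgebraicClosure K) ((minpoly K x).coeff 0) =
      (p.roots.map fun l => -l).prod := by
    rw [← coeff_map, coeff_zero_eq_eval_zero, ← hp, hs.eq_prod_roots_of_monic hm,
      eval_multiset_prod, Multiset.map_map]
    simp [← hs.eq_prod_roots_of_monic hm]
  rw [← spectralNorm_extends (L := AlgebraicClosure K), h0, spectralNorm_multiset_prod,
    Multiset.map_map, Multiset.map_congr rfl (fun l hl => by
      rw [Function.comp_apply, spectralNorm_neg', hroot l hl]), Multiset.map_const',
    Multiset.prod_replicate, IsAlgClosed.card_roots_eq_natDegree, natDegree_map]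

/-- A polynomial over `K̄` of small degree vanishing at a split element is zero. -/
theorem eq_zero_of_aeval_splitting (x : D) {q : (AlgebraicClosure K)[X]}
    (hq : aeval (splitting K D x) q = 0) (hdeg : q.natDegree < (minpoly K x).natDegree) : q = 0 := by
  have := isSimpleRing_tensor K D (AlgebraicClosure K)
  have : Nonempty (Fin (degree K D)) := ⟨⟨0, degree_pos K⟩⟩
  -- The source is a simple ring, so the extension of the splitting to `D ⊗ K̄` is injective and
  -- relations among split elements can be tested there.
  let Φ : D ⊗[K] AlgebraicClosure K →ₐ[K]
      Matrix (Fin (degree K D)) (Fin (degree K D)) (AlgebraicClosure K) :=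
    Algebra.TensorProduct.lift (splitting K D)
      ((Algebra.ofId (AlgebraicClosure K) _).restrictScalars K)
      (fun a b => (Algebra.commutes b (splitting K D a)).symm)
  have hΦ : Function.Injective Φ := RingHom.injective Φ.toRingHom
  set n := (minpoly K x).natDegree
  have hLI : LinearIndependent K fun i : Fin n => x ^ (i : ℕ) := linearIndependent_pow x
  have hsum : ∑ i : Fin n, (x ^ (i : ℕ)) ⊗ₜ[K] q.coeff i = 0 := by
    apply hΦ
    rw [map_zero, map_sum, ← hq, aeval_eq_sum_range' hdeg, Finset.sum_range]
    refine Finset.sum_congr rfl fun i _ => ?_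
    change splitting K D (x ^ (i : ℕ)) * algebraMap _ _ (q.coeff i) = _
    rw [map_pow, Algebra.smul_def]
    exact (Algebra.commutes (q.coeff i) (splitting K D x ^ (i : ℕ))).symm
  have hcoeff : ∀ i : Fin n, q.coeff i = 0 := by
    intro i
    -- `g` is a functional on `D` dual to `x^i` among the powers of `x`; applying `g ⊗ id` to the
    -- relation isolates the coefficient.
    obtain ⟨g, hg⟩ := LinearMap.exists_extend ((Finsupp.lapply i : (Fin n →₀ K) →ₗ[K] K).comp hLI.repr : _ →ₗ[K] K)
    have hgi : ∀ j : Fin n, g (x ^ (j : ℕ)) = if j = i then 1 else 0 := by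
      intro j
      have h1 := LinearMap.congr_fun hg ⟨x ^ (j : ℕ), Submodule.subset_span ⟨j, rfl⟩⟩
      have h2 := hLI.repr_eq_single j ⟨x ^ (j : ℕ), Submodule.subset_span ⟨j, rfl⟩⟩ rfl
      simp only [LinearMap.comp_apply, h2, Submodule.subtype_apply,
        Finsupp.lapply_apply, Finsupp.single_apply] at h1
      exact h1
    have h3 := congrArg (TensorProduct.lid K _ ∘ LinearMap.rTensor (AlgebraicClosure K) g) hsum
    simpa [hgi, ite_smul] using h3
  ext i
  rw [coeff_zero]
  by_cases hi : i < n
  · exact hcoeff ⟨i, hi⟩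
  · exact coeff_eq_zero_of_natDegree_lt (by omega)

/-- Otherwise Cayley–Hamilton would give a nonzero annihilating polynomial over `K̄` of too small a
degree. -/
theorem natDegree_minpoly_le (x : D) : (minpoly K x).natDegree ≤ degree K D := by
  by_contra! h
  have h1 := eq_zero_of_aeval_splitting x (Matrix.aeval_self_charpoly _)
    (by rwa [Matrix.charpoly_natDegree_eq_dim, Fintype.card_fin])
  exact (Matrix.charpoly_monic _).ne_zero h1

/-- Both polynomials are monic of degree `d` and annihilate the split element, so their difference
is an annihilator of degree below `d`. -/
theorem charpoly_splitting {x : D} (h : (minpoly K x).natDegree = degree K D) :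
    (splitting K D x).charpoly = (minpoly K x).map (algebraMap K (AlgebraicClosure K)) := by
  have hx : IsIntegral K x := Algebra.IsIntegral.isIntegral x
  have hm := (minpoly.monic hx).map (algebraMap K (AlgebraicClosure K))
  have hd : (splitting K D x).charpoly.natDegree = degree K D := by
    rw [Matrix.charpoly_natDegree_eq_dim, Fintype.card_fin]
  rw [← sub_eq_zero]
  refine eq_zero_of_aeval_splitting x ?_ ?_
  · rw [map_sub, Matrix.aeval_self_charpoly, aeval_map_algebraMap, aeval_algHom_apply,
      minpoly.aeval, map_zero, sub_zero]
  · rw [h]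
    have hlt := degree_sub_lt_left (p := (splitting K D x).charpoly)
      (q := (minpoly K x).map (algebraMap K (AlgebraicClosure K))) (by
        rw [degree_eq_natDegree (Matrix.charpoly_monic _).ne_zero, degree_eq_natDegree hm.ne_zero,
          hd, natDegree_map, h]) (Matrix.charpoly_monic _).ne_zero (by
        rw [(Matrix.charpoly_monic _).leadingCoeff, hm.leadingCoeff])
    by_cases h0 : (splitting K D x).charpoly - (minpoly K x).map (algebraMap K _) = 0
    · rw [h0, natDegree_zero]; exact degree_pos K
    · exact (natDegree_lt_natDegree h0 hlt).trans_eq hd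

end MinimalPolynomials

/-! ### The uniformiser and the powers of the maximal ideal -/

section Uniformiser

set_option linter.unusedSectionVars false

variable {K : Type*} {D : Type*} [NontriviallyNormedField K] [IsUltrametricDist K]
  [CompleteSpace K] [DivisionRing D] [Algebra K D] [FiniteDimensional K D]
  [Algebra.IsCentral K D]

theorem mem_intD_iff {x : D} : x ∈ intD K D ↔ absD K x ≤ 1 := zero_le_val_iff K x

theorem mem_maxD_iff {x : intD K D} : x ∈ maxD K D ↔ absD K (x : D) < 1 := zero_lt_val_iff K (x : D)

variable {π : intD K D} (hπ : Ideal.span {π} = maxD K D)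
include hπ

theorem absD_uniformiser_lt : absD K (π : D) < 1 :=
  mem_maxD_iff.1 (hπ ▸ Ideal.mem_span_singleton_self π)

theorem absD_le_uniformiser {x : D} (hx : absD K x < 1) : absD K x ≤ absD K (π : D) := by
  have h1 : (⟨x, mem_intD_iff.2 hx.le⟩ : intD K D) ∈ Ideal.span {π} := by
    rw [hπ, mem_maxD_iff]; exact hx
  obtain ⟨y, hy⟩ := Submodule.mem_span_singleton.1 h1
  have h2 : (y : D) * π = x := congrArg Subtype.val hy
  rw [← h2, absD_mul]
  exact mul_le_of_le_one_left (absD_nonneg K _) (mem_intD_iff.1 y.2)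

theorem uniformiser_pos : 0 < absD K (π : D) := by
  obtain ⟨c, hc, hc'⟩ := NormedField.exists_norm_lt_one K
  rw [← absD_algebraMap (D := D)] at hc hc'
  exact hc.trans_le (absD_le_uniformiser hπ hc')

theorem uniformiser_ne_zero : (π : D) ≠ 0 := by
  intro h
  have := uniformiser_pos hπ
  rw [h, absD_zero] at this
  exact lt_irrefl _ this

theorem exists_absD_eq_zpow {x : D} (hx : x ≠ 0) : ∃ j : ℤ, absD K x = absD K (π : D) ^ j := by
  have h0 := uniformiser_pos hπ
  have h1 := absD_uniformiser_lt hπ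
  obtain ⟨n, hn, hn'⟩ := exists_mem_Ico_zpow (absD_pos K hx) ((one_lt_inv₀ h0).2 h1)
  have hz : ∀ j : ℤ, absD K ((π : D) ^ j) = absD K (π : D) ^ j := by
    intro j
    cases j with
    | ofNat j => simp [absD_pow']
    | negSucc j => simp [absD_pow', absD_inv]
  refine ⟨-n, le_antisymm ?_ ?_⟩
  -- A value strictly between consecutive powers of `|π|` would give, after division, a value
  -- strictly between `|π|` and `1`.
  · by_contra! hlt
    have h2 : absD K (x⁻¹ * (π : D) ^ (-n)) < 1 := by
      rw [absD_mul, absD_inv, hz, inv_mul_lt_one₀ (absD_pos K hx)]; exact hlt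
    have h3 := absD_le_uniformiser hπ h2
    rw [absD_mul, absD_inv, hz, inv_mul_le_iff₀ (absD_pos K hx)] at h3
    rw [inv_zpow', neg_add, zpow_add₀ h0.ne', zpow_neg_one] at hn'
    have h4 := mul_lt_mul_of_pos_right hn' h0
    rw [inv_mul_cancel_right₀ h0.ne'] at h4
    exact absurd h3 (not_le.2 h4)
  · rwa [inv_zpow'] at hn

theorem mem_maxD_pow_iff {x : intD K D} (m : ℕ) :
    x ∈ maxD K D ^ m ↔ absD K (x : D) ≤ absD K (π : D) ^ m := by
  have h0 := uniformiser_pos hπ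
  induction m generalizing x with
  | zero =>
    rw [Submodule.pow_zero, Ideal.one_eq_top, pow_zero]
    exact ⟨fun _ => mem_intD_iff.1 x.2, fun _ => Submodule.mem_top⟩
  | succ m ih =>
    rw [Submodule.pow_succ, pow_succ]
    constructor
    · intro hx
      refine Submodule.mul_induction_on (r := x) hx (C := fun x : intD K D => absD K (x : D) ≤ _) ?_ ?_
      · intro a ha b hb
        rw [Subring.coe_mul, absD_mul]
        exact mul_le_mul (ih.1 ha) (absD_le_uniformiser hπ (mem_maxD_iff.1 hb)) (absD_nonneg K _)
          (pow_nonneg h0.le m)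
      · intro a b ha hb
        exact (absD_add_le K _ _).trans (max_le ha hb)
    · intro hx
      have hy : absD K ((x : D) * (π : D)⁻¹) ≤ absD K (π : D) ^ m := by
        rw [absD_mul, absD_inv, mul_inv_le_iff₀ h0]; exact hx
      have hy1 : absD K ((x : D) * (π : D)⁻¹) ≤ 1 :=
        hy.trans (pow_le_one₀ h0.le (absD_uniformiser_lt hπ).le)
      have hxy : x = ⟨(x : D) * (π : D)⁻¹, mem_intD_iff.2 hy1⟩ * π :=
        Subtype.ext (inv_mul_cancel_right₀ (uniformiser_ne_zero hπ) _).symm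
      rw [hxy]
      exact Ideal.mul_mem_mul (ih.2 hy) (hπ ▸ Ideal.mem_span_singleton_self π)

end Uniformiser

/-! ### Generators with nonzero trace over finite fields -/

section FiniteFields

open Polynomial

/-- A generator of a normal basis of an extension of finite fields has full degree and nonzero
trace. -/
theorem exists_generator_trace_ne_zero_of_field (k L : Type*) [Field k] [Field L] [Finite L]
    [Algebra k L] [Module.Finite k L] :
    ∃ w : L, (minpoly k w).natDegree = Module.finrank k L ∧ (minpoly k w).nextCoeff ≠ 0 := by
  have : Finite k := Finite.of_injective _ (algebraMap k L).injective
  set b := IsGalois.normalBasis k L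
  have hb : ∀ σ : Gal(L/k), σ (b 1) = b σ := fun σ => (IsGalois.normalBasis_apply σ).symm
  refine ⟨b 1, ?_, ?_⟩
  · rw [← Field.primitive_element_iff_minpoly_natDegree_eq,
      Field.primitive_element_iff_algHom_eq_of_eval k L (fun x => Normal.splits inferInstance x) _
        (AlgHom.id k L)]
    intro ψ hψ
    obtain ⟨σ, rfl⟩ : ∃ σ : Gal(L/k), (σ : L →ₐ[k] L) = ψ :=
      ⟨AlgEquiv.ofBijective ψ (Algebra.IsAlgebraic.algHom_bijective ψ), AlgHom.ext fun _ => rfl⟩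
    -- An automorphism fixing `b 1` fixes the index of a basis vector, so it is the identity; hence
    -- `b 1` generates the extension.
    have h1 : b 1 = b σ := hψ.trans (hb σ)
    rw [← b.injective h1]
    rfl
  · intro h0
    have h1 : Algebra.trace k L (b 1) = 0 := by
      rw [trace_eq_finrank_mul_minpoly_nextCoeff, h0, neg_zero, mul_zero]
    -- Trace zero would be a linear relation among the normal basis with all coefficients `1`.
    have h2 := trace_eq_sum_automorphisms (K := k) (b 1)
    rw [h1, map_zero] at h2
    simp only [hb] at h2
    have h3 := Fintype.linearIndependent_iff.1 b.linearIndependent (fun _ => 1)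
      (by simpa using h2.symm) 1
    exact one_ne_zero h3

/-- Meant for `O_D / m_D`, not known to be commutative beforehand: by Wedderburn's little theorem a
finite domain is a field. -/
theorem exists_generator_trace_ne_zero (k R : Type*) [Field k] [Finite k] [Ring R] [IsDomain R]
    [Algebra k R] [Module.Finite k R] :
    ∃ w : R, (minpoly k w).natDegree = Module.finrank k R ∧ (minpoly k w).nextCoeff ≠ 0 := by
  have : Finite R := Module.finite_of_finite k
  exact @exists_generator_trace_ne_zero_of_field k R _ (Finite.isDomain_to_isField R).toField
    ‹_› ‹_› ‹_›

end FiniteFields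

/-! ### The residue ring, ramification and the equality `e = f = d` -/

section Residue

set_option linter.unusedSectionVars false

open Polynomial
open scoped NormedField Valued

variable (K : Type*) (D : Type*) [NontriviallyNormedField K] [IsUltrametricDist K]
  [ProperSpace K] [DivisionRing D] [Algebra K D] [FiniteDimensional K D]
  [Algebra.IsCentral K D]

/-- `degree` is defined by a truncated square root; over `K̄` the algebra becomes a matrix algebra,
so the dimension is a perfect square and nothing is lost. -/
theorem finrank_eq_degree_mul_degree : Module.finrank K D = degree K D * degree K D := by
  let L := AlgebraicClosure K
  have := isSimpleRing_tensor K D L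
  have : IsSimpleRing (L ⊗[K] D) :=
    IsSimpleRing.of_ringEquiv (Algebra.TensorProduct.comm K D L).toRingEquiv inferInstance
  obtain ⟨n, _, ⟨e⟩⟩ := IsSimpleRing.exists_algEquiv_matrix_of_isAlgClosed L (L ⊗[K] D)
  have hn : Module.finrank K D = n * n := by
    rw [← Module.finrank_baseChange (R := L) (S := K) (M' := D), e.toLinearEquiv.finrank_eq,
      Module.finrank_matrix]
    simp
  rw [degree, hn, Nat.sqrt_eq]

/-- Properness makes the closed unit ball `O_K` compact. -/
theorem isDiscreteValuationRing_integer : IsDiscreteValuationRing 𝒪[K] ∧ Finite 𝓀[K] := by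
  let _ : (Valued.v : Valuation K _).RankOne :=
    inferInstanceAs (NormedField.valuation (K := K)).RankOne
  have h : CompactSpace 𝒪[K] := by
    refine isCompact_iff_compactSpace (s := (𝒪[K] : Set K)).1 ?_
    convert isCompact_closedBall (0 : K) 1 using 1
    ext x
    simp [Valued.integer.mem_iff]
  exact (Valued.integer.compactSpace_iff_completeSpace_and_isDiscreteValuationRing_and_finite_residueField.1 h).2

instance : IsDiscreteValuationRing 𝒪[K] := (isDiscreteValuationRing_integer K).1

instance : Finite 𝓀[K] := (isDiscreteValuationRing_integer K).2

/-- The inclusion `O_K → O_D`. -/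
def baseInt : 𝒪[K] →+* intD K D :=
  ((algebraMap K D).comp 𝒪[K].subtype).codRestrict (intD K D) fun c => mem_intD_iff.2 (by
    rw [RingHom.comp_apply, absD_algebraMap]; exact Valued.integer.norm_le_one c)

theorem baseInt_commutes (c : 𝒪[K]) (x : intD K D) : baseInt K D c * x = x * baseInt K D c :=
  Subtype.ext (Algebra.commutes (c : K) (x : D))

/-- The residue ring `O_D / m_D`. -/
abbrev ResD : Type _ := intD K D ⧸ maxD K D

/-- The inclusion of residue fields. -/
def resMap : 𝓀[K] →+* ResD K D :=
  Ideal.Quotient.lift 𝓂[K] ((Ideal.Quotient.mk (maxD K D)).comp (baseInt K D)) (by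
    intro c hc
    rw [RingHom.comp_apply, Ideal.Quotient.eq_zero_iff_mem, mem_maxD_iff]
    change absD K (algebraMap K D c) < 1
    rw [absD_algebraMap]
    refine lt_of_le_of_ne (Valued.integer.norm_le_one c) fun h => ?_
    exact (IsLocalRing.mem_maximalIdeal c).1 hc (Valued.integer.isUnit_iff_norm_eq_one.2 h))

theorem resMap_residue (c : 𝒪[K]) :
    resMap K D (IsLocalRing.residue 𝒪[K] c) = Ideal.Quotient.mk (maxD K D) (baseInt K D c) := rfl

instance : Algebra 𝓀[K] (ResD K D) := (resMap K D).toAlgebra' (by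
  intro c x
  obtain ⟨c, rfl⟩ := IsLocalRing.residue_surjective c
  obtain ⟨x, rfl⟩ := Ideal.Quotient.mk_surjective x
  rw [resMap_residue, ← map_mul, ← map_mul, baseInt_commutes])

theorem residue_smul (c : 𝒪[K]) (x : intD K D) :
    IsLocalRing.residue 𝒪[K] c • Ideal.Quotient.mk (maxD K D) x =
      Ideal.Quotient.mk (maxD K D) (baseInt K D c * x) := by
  rw [Algebra.smul_def, map_mul]; rfl

instance : IsDomain (ResD K D) := by
  have : Nontrivial (ResD K D) := by
    refine Ideal.Quotient.nontrivial_iff.2 fun h => ?_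
    have h1 := (Ideal.eq_top_iff_one _).1 h
    rw [mem_maxD_iff, Subring.coe_one, absD_one] at h1
    exact lt_irrefl _ h1
  have : NoZeroDivisors (ResD K D) := ⟨by
    intro x y h
    obtain ⟨x, rfl⟩ := Ideal.Quotient.mk_surjective x
    obtain ⟨y, rfl⟩ := Ideal.Quotient.mk_surjective y
    rw [← map_mul, Ideal.Quotient.eq_zero_iff_mem, mem_maxD_iff, Subring.coe_mul, absD_mul] at h
    simp only [Ideal.Quotient.eq_zero_iff_mem, mem_maxD_iff]
    by_contra! hcon
    exact absurd h (not_lt.2 (one_le_mul_of_one_le_of_one_le hcon.1 hcon.2))⟩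
  exact NoZeroDivisors.to_isDomain _

variable {K D}

/-- Elements of `O_D` with linearly independent residues are linearly independent over `K`. -/
theorem linearIndependent_of_residue {ι : Type*} [Finite ι] {v : ι → intD K D}
    (h : LinearIndependent 𝓀[K] fun i => Ideal.Quotient.mk (maxD K D) (v i)) :
    LinearIndependent K fun i => (v i : D) := by
  have := Fintype.ofFinite ι
  rw [Fintype.linearIndependent_iff] at h ⊢
  intro g hg
  by_contra! hcon
  obtain ⟨i₀, hi₀⟩ := hcon
  have : Nonempty ι := ⟨i₀⟩
  -- Dividing by a coefficient of largest norm makes the relation integral with one coefficient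
  -- equal to `1`, so it stays nontrivial after reduction.
  obtain ⟨j, hj⟩ := Finite.exists_max fun i => ‖g i‖
  have hj0 : g j ≠ 0 := norm_pos_iff.1 ((norm_pos_iff.2 hi₀).trans_le (hj i₀))
  let c : ι → 𝒪[K] := fun i => ⟨g i / g j, Valued.integer.mem_iff.2 (by
    rw [norm_div]; exact div_le_one_of_le₀ (hj i) (norm_nonneg _))⟩
  have h1 : ∑ i, baseInt K D (c i) * v i = 0 := by
    apply Subtype.ext
    rw [AddSubmonoidClass.coe_finsetSum]
    calc ∑ i, algebraMap K D (g i / g j) * (v i : D) = (g j)⁻¹ • ∑ i, g i • (v i : D) := by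
          rw [Finset.smul_sum]
          refine Finset.sum_congr rfl fun i _ => ?_
          rw [smul_smul, Algebra.smul_def, div_eq_inv_mul]
      _ = 0 := by rw [hg, smul_zero]
  have h2 := h (fun i => IsLocalRing.residue 𝒪[K] (c i)) (by
    simp only [residue_smul, ← map_sum, h1, map_zero]) j
  have h3 : c j = 1 := Subtype.ext (div_self hj0)
  rw [h3, map_one] at h2
  exact one_ne_zero h2

instance : Module.Finite 𝓀[K] (ResD K D) := by
  have h : Module.rank 𝓀[K] (ResD K D) ≤ (Module.finrank K D : ℕ) := by
    refine rank_le fun s hs => ?_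
    have hout : ∀ x : ResD K D, ∃ y, Ideal.Quotient.mk (maxD K D) y = x :=
      Ideal.Quotient.mk_surjective
    choose f hf using hout
    have h1 : LinearIndependent K fun i : s => (f i : D) :=
      linearIndependent_of_residue (by simpa only [hf] using hs)
    simpa using h1.fintype_card_le_finrank
  exact Module.rank_lt_aleph0_iff.1 (h.trans_lt (Cardinal.natCast_lt_aleph0))

/-- A subspace to which every vector is relatively close is the whole space. -/
theorem eq_top_of_absD_sub_le {V : Submodule K D} {ρ : ℝ} (h0 : 0 < ρ) (h1 : ρ < 1)
    (h : ∀ x : D, ∃ v ∈ V, absD K (x - v) ≤ ρ * absD K x) : V = ⊤ := by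
  -- With `absD` as norm, `V` is closed because it is finite-dimensional over a complete field.
  let N : AddGroupNorm D :=
    { toFun := absD K
      map_zero' := absD_zero K
      add_le' := fun x y => (absD_add_le K x y).trans
        (max_le_add_of_nonneg (absD_nonneg K x) (absD_nonneg K y))
      neg' := absD_neg K
      eq_zero_of_map_eq_zero' := fun x hx => by
        by_contra h0
        exact absD_ne_zero K h0 hx }
  let _ : NormedAddCommGroup D := N.toNormedAddCommGroup
  have hnorm : ∀ x : D, ‖x‖ = absD K x := fun _ => rfl
  let _ : NormedSpace K D := { norm_smul_le := fun c x => (absD_smul c x).le }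
  have hV : IsClosed (V : Set D) := Submodule.closed_of_finiteDimensional V
  rw [Submodule.eq_top_iff']
  intro x
  by_contra hx
  have hne : (V : Set D).Nonempty := ⟨0, V.zero_mem⟩
  have hδ : 0 < Metric.infDist x V := (hV.notMem_iff_infDist_pos hne).1 hx
  -- Choose `v` at distance less than `δ/ρ` from `x`, where `δ` is the distance from `x` to `V`; one
  -- further approximation then comes closer than `δ`.
  obtain ⟨v, hv, hxv⟩ := (Metric.infDist_lt_iff hne).1
    ((lt_div_iff₀ h0).2 (mul_lt_of_lt_one_right hδ h1))
  obtain ⟨v', hv', hxv'⟩ := h (x - v)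
  have h3 := Metric.infDist_le_dist_of_mem (x := x) (V.add_mem hv hv')
  rw [dist_eq_norm, hnorm] at hxv h3
  rw [sub_sub] at hxv'
  rw [lt_div_iff₀ h0, mul_comm] at hxv
  exact absurd (h3.trans hxv') (not_le.2 hxv)

theorem norm_le_of_irreducible {ϖ : 𝒪[K]} (hϖ : Irreducible ϖ) {c : K} (hc : ‖c‖ < 1) :
    ‖c‖ ≤ ‖(ϖ : K)‖ := by
  have h1 : (⟨c, Valued.integer.mem_iff.2 hc.le⟩ : 𝒪[K]) ∈ (𝓂[K] : Set 𝒪[K]) := by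
    refine (IsLocalRing.mem_maximalIdeal _).2 fun h => ?_
    exact hc.ne (Valued.integer.isUnit_iff_norm_eq_one.1 h)
  rw [hϖ.maximalIdeal_eq_closedBall] at h1
  simpa using h1

variable {π : intD K D} (hπ : Ideal.span {π} = maxD K D)
include hπ

/-- The inequality `[D : K] ≤ e f`. -/
theorem finrank_le_mul {ϖ : K} {e : ℕ} (he : 0 < e) (hϖ : ‖ϖ‖ = absD K (π : D) ^ e) :
    Module.finrank K D ≤ Module.finrank 𝓀[K] (ResD K D) * e := by
  have hπ0 := uniformiser_pos hπ
  have hϖ0 : ϖ ≠ 0 := by rw [← norm_pos_iff, hϖ]; positivity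
  set f := Module.finrank 𝓀[K] (ResD K D) with hf
  let b := Module.finBasis 𝓀[K] (ResD K D)
  choose a ha using fun i => Ideal.Quotient.mk_surjective (b i)
  -- The `ef` products of lifted residue basis vectors with `π^i`, `i < e`, span: with `s` and `i`
  -- from Euclidean division by `e`, each `x ≠ 0` is `ϖ^s u π^i` with `|u| = 1`, and expanding the
  -- residue of `u` approximates `x` up to the factor `|π|`.
  let v : Fin f × Fin e → D := fun p => (a p.1 : D) * (π : D) ^ (p.2 : ℕ)
  have hV : Submodule.span K (Set.range v) = ⊤ := by
    refine eq_top_of_absD_sub_le hπ0 (absD_uniformiser_lt hπ) fun x => ?_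
    by_cases hx : x = 0
    · exact ⟨0, zero_mem _, by simp [hx, absD_zero]⟩
    obtain ⟨j, hj⟩ := exists_absD_eq_zpow hπ hx
    obtain ⟨s, i, hi, hsi⟩ : ∃ (s : ℤ) (i : ℕ), i < e ∧ j = e * s + i := by
      have he' : (0 : ℤ) < e := by exact_mod_cast he
      have h1 := Int.emod_nonneg j he'.ne'
      have h2 := Int.emod_lt_of_pos j he'
      have h3 := Int.mul_ediv_add_emod j e
      refine ⟨j / e, (j % e).toNat, by omega, by rw [Int.toNat_of_nonneg h1, h3]⟩
    have hxa : absD K x = ‖ϖ ^ s‖ * absD K ((π : D) ^ i) := by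
      rw [hj, hsi, absD_pow', norm_zpow, hϖ, zpow_add₀ hπ0.ne', zpow_mul, zpow_natCast,
        zpow_natCast]
    have hs0 : ϖ ^ s ≠ 0 := zpow_ne_zero _ hϖ0
    have hi0 : (π : D) ^ i ≠ 0 := pow_ne_zero _ (uniformiser_ne_zero hπ)
    obtain ⟨u, hu⟩ : ∃ u : D, x = ϖ ^ s • (u * (π : D) ^ i) :=
      ⟨(ϖ ^ s)⁻¹ • (x * ((π : D) ^ i)⁻¹), by
        rw [smul_mul_assoc, inv_mul_cancel_right₀ hi0, smul_inv_smul₀ hs0]⟩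
    have hu1 : absD K u ≤ 1 := by
      have h1 : absD K x = absD K x * absD K u := by
        conv_lhs => rw [hu]
        rw [absD_smul, absD_mul, hxa]; ring
      exact ((mul_eq_left₀ (absD_ne_zero K hx)).1 h1.symm).le
    obtain ⟨u, rfl⟩ : ∃ u' : intD K D, (u' : D) = u := ⟨⟨u, mem_intD_iff.2 hu1⟩, rfl⟩
    choose c hc using fun l =>
      IsLocalRing.residue_surjective (R := 𝒪[K]) (b.repr (Ideal.Quotient.mk (maxD K D) u) l)
    have hmem : u - ∑ l, baseInt K D (c l) * a l ∈ maxD K D := by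
      rw [← Ideal.Quotient.eq, map_sum]
      conv_lhs => rw [← b.sum_repr (Ideal.Quotient.mk (maxD K D) u)]
      refine Finset.sum_congr rfl fun l _ => ?_
      rw [← hc, ← ha, residue_smul]
    refine ⟨∑ l, (ϖ ^ s * (c l : K)) • v (l, ⟨i, hi⟩), Submodule.sum_mem _ fun l _ =>
      Submodule.smul_mem _ _ (Submodule.subset_span ⟨_, rfl⟩), ?_⟩
    have hdiff : x - ∑ l, (ϖ ^ s * (c l : K)) • v (l, ⟨i, hi⟩) =
        ϖ ^ s • (((u - ∑ l, baseInt K D (c l) * a l : intD K D) : D) * (π : D) ^ i) := by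
      rw [AddSubgroupClass.coe_sub, AddSubmonoidClass.coe_finsetSum, sub_mul, smul_sub, ← hu,
        Finset.sum_mul, Finset.smul_sum]
      congr 1
      refine Finset.sum_congr rfl fun l _ => ?_
      rw [mul_smul, Subring.coe_mul, mul_assoc, Algebra.smul_def (c l : K)]
      rfl
    rw [hdiff, absD_smul, absD_mul, hxa]
    have := absD_le_uniformiser hπ (mem_maxD_iff.1 hmem)
    calc _ ≤ ‖ϖ ^ s‖ * (absD K (π : D) * absD K ((π : D) ^ i)) := by
          gcongr
          exact absD_nonneg K _
      _ = _ := by ring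
  rw [← finrank_top K D, ← hV]
  exact (finrank_range_le_card v).trans_eq (by simp)

/-- The ramification index and the residue degree of `D` both equal the degree; there is an element
of `O_D` whose minimal polynomial has full degree and unit trace. -/
theorem exists_unit_trace {ϖ : 𝒪[K]} (hϖ : Irreducible ϖ) :
    ‖(ϖ : K)‖ = absD K (π : D) ^ degree K D ∧ ∃ (w : intD K D) (p : 𝒪[K][X]), p.Monic ∧
      p.natDegree = degree K D ∧ p.map 𝒪[K].subtype = minpoly K (w : D) ∧
      IsUnit (p.coeff (degree K D - 1)) := by
  have hπ0 := uniformiser_pos hπ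
  have hπ1 := absD_uniformiser_lt hπ
  have hdpos := degree_pos K (D := D)
  obtain ⟨e, he0, he⟩ : ∃ e : ℕ, 0 < e ∧ ‖(ϖ : K)‖ = absD K (π : D) ^ e := by
    have hϖ0 : algebraMap K D ϖ ≠ 0 := by
      rw [Ne, map_eq_zero_iff _ (algebraMap K D).injective]
      exact fun h => hϖ.ne_zero (Subtype.ext h)
    obtain ⟨j, hj⟩ := exists_absD_eq_zpow hπ hϖ0
    rw [absD_algebraMap] at hj
    have hlt : ‖(ϖ : K)‖ < 1 := Valued.integer.norm_irreducible_lt_one hϖ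
    rw [hj, zpow_lt_one_iff_right_of_lt_one₀ hπ0 hπ1] at hlt
    lift j to ℕ using hlt.le
    exact ⟨j, by exact_mod_cast hlt, by rw [hj, zpow_natCast]⟩
  -- The constant term of the minimal polynomial of `π` lies in `m_K`, so its norm `|π|^n`, with `n
  -- ≤ d`, is at most `|ϖ| = |π|^e`.
  have hed : e ≤ degree K D := by
    have hint : IsIntegral K (π : D) := Algebra.IsIntegral.isIntegral _
    have h1 := norm_coeff_zero_minpoly (K := K) (π : D)
    have h2 : ‖(minpoly K (π : D)).coeff 0‖ < 1 := by
      rw [h1]; exact pow_lt_one₀ hπ0.le hπ1 (minpoly.natDegree_pos hint).ne'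
    have h3 := norm_le_of_irreducible hϖ h2
    rw [h1, he, pow_le_pow_iff_right_of_lt_one₀ hπ0 hπ1] at h3
    exact h3.trans (natDegree_minpoly_le _)
  obtain ⟨w', hw', htr⟩ := exists_generator_trace_ne_zero 𝓀[K] (ResD K D)
  obtain ⟨w, rfl⟩ := Ideal.Quotient.mk_surjective w'
  have hint : IsIntegral K (w : D) := Algebra.IsIntegral.isIntegral _
  obtain ⟨p, hp, hpd, hpm⟩ : ∃ p : 𝒪[K][X], p.map 𝒪[K].subtype = minpoly K (w : D) ∧
      p.natDegree = (minpoly K (w : D)).natDegree ∧ p.Monic := by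
    refine lifts_and_natDegree_eq_and_monic ?_ (minpoly.monic hint)
    rw [lifts_iff_coeff_lifts]
    exact fun n => ⟨⟨_, Valued.integer.mem_iff.2
      (norm_coeff_minpoly_le_one (mem_intD_iff.1 w.2) n)⟩, rfl⟩
  have hroot : eval₂ (baseInt K D) w p = 0 := by
    apply Subtype.ext
    change (intD K D).subtype _ = 0
    rw [hom_eval₂]
    have h1 : (intD K D).subtype.comp (baseInt K D) = (algebraMap K D).comp 𝒪[K].subtype := rfl
    rw [h1, ← eval₂_map, hp]
    exact minpoly.aeval K (w : D)
  set q := p.map (IsLocalRing.residue 𝒪[K]) with hq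
  have hqm : q.Monic := hpm.map _
  have hqd : q.natDegree = p.natDegree := hpm.natDegree_map _
  -- The reduction `q` of the integral minimal polynomial of `w` annihilates the residue of `w`,
  -- whose degree is `f`; hence `f ≤ d`.
  have hdvd : minpoly 𝓀[K] (Ideal.Quotient.mk (maxD K D) w) ∣ q := by
    refine minpoly.dvd _ _ ?_
    rw [aeval_def, hq, eval₂_map]
    have h1 : (algebraMap 𝓀[K] (ResD K D)).comp (IsLocalRing.residue 𝒪[K]) =
        (Ideal.Quotient.mk (maxD K D)).comp (baseInt K D) := rfl
    rw [h1, ← hom_eval₂, hroot, map_zero]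
  have hfd : Module.finrank 𝓀[K] (ResD K D) ≤ degree K D := by
    rw [← hw']
    refine (natDegree_le_of_dvd hdvd hqm.ne_zero).trans ?_
    rw [hqd, hpd]
    exact natDegree_minpoly_le _
  -- Now `d² ≤ ef` with `e ≤ d` and `f ≤ d` forces equality.
  have hef := finrank_le_mul hπ he0 he
  rw [finrank_eq_degree_mul_degree] at hef
  have hed' : e = degree K D := by
    refine le_antisymm hed (Nat.le_of_mul_le_mul_left (hef.trans (Nat.mul_le_mul_right e hfd)) hdpos)
  have hfd' : Module.finrank 𝓀[K] (ResD K D) = degree K D := by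
    refine le_antisymm hfd (Nat.le_of_mul_le_mul_right ?_ hdpos)
    rwa [hed'] at hef
  have hpd' : p.natDegree = degree K D := by
    refine le_antisymm (hpd ▸ natDegree_minpoly_le _) ?_
    rw [← hfd', ← hw', ← hqd]
    exact natDegree_le_of_dvd hdvd hqm.ne_zero
  refine ⟨hed' ▸ he, w, p, hpm, hpd', hp, ?_⟩
  -- Equal degrees turn divisibility into equality, so the nonzero residual trace says that the
  -- coefficient of `p` in degree `d - 1` is a unit.
  have hqe : minpoly 𝓀[K] (Ideal.Quotient.mk (maxD K D) w) = q := by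
    symm
    refine eq_of_monic_of_dvd_of_natDegree_le
      (minpoly.monic (Algebra.IsIntegral.isIntegral _)) hqm hdvd ?_
    rw [hqd, hpd', hw', hfd']
  rw [hqe, nextCoeff_of_natDegree_pos (by rw [hqd, hpd']; exact hdpos), hqd, hpd', hq,
    coeff_map] at htr
  rwa [IsLocalRing.residue_ne_zero_iff_isUnit] at htr

end Residue

/-! ### Surjectivity of the reduced norm on congruence subgroups and of reduction -/

section ReducedNorm

set_option linter.unusedSectionVars false

open Polynomial
open scoped NormedField Valued

variable {K : Type*} {D : Type*} [NontriviallyNormedField K] [IsUltrametricDist K]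
  [ProperSpace K] [DivisionRing D] [Algebra K D] [FiniteDimensional K D]
  [Algebra.IsCentral K D]

/-- Banach's fixed point theorem: polynomials over `O_K` are 1-Lipschitz on `O_K`, so the right-hand
side contracts by `‖a‖`. -/
theorem exists_eq_add_mul_eval {a : 𝒪[K]} (ha : ‖a‖ < 1) (b : 𝒪[K]) (G : 𝒪[K][X]) :
    ∃ y, y = b + a * G.eval y := by
  have hcl : IsClosed ((𝒪[K] : Subring K) : Set K) := by
    convert Metric.isClosed_closedBall (x := (0 : K)) (ε := 1) using 1
    ext x
    simp [Valued.integer.mem_iff]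
  have : CompleteSpace 𝒪[K] := hcl.completeSpace_coe
  have hc : ContractingWith ⟨‖a‖, norm_nonneg a⟩ fun y : 𝒪[K] => b + a * G.eval y := by
    refine ⟨ha, LipschitzWith.of_dist_le_mul fun x y => ?_⟩
    obtain ⟨z, hz⟩ := G.sub_dvd_eval_sub x y
    rw [dist_eq_norm, dist_eq_norm, add_sub_add_left_eq_sub, ← mul_sub, hz]
    refine (norm_mul_le _ _).trans ?_
    refine mul_le_mul_of_nonneg_left ?_ (norm_nonneg a)
    refine (norm_mul_le _ _).trans ?_
    exact mul_le_of_le_one_right (norm_nonneg _) (Valued.integer.norm_le_one z)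
  exact ⟨_, hc.fixedPoint_isFixedPt.symm⟩

/-- In full degree the minimal polynomial is the characteristic polynomial, and `det(1 - tA)` is its
reversal at `t`. -/
theorem det_one_sub_smul {w : intD K D} {p : 𝒪[K][X]} (hd : p.natDegree = degree K D)
    (hp : p.map 𝒪[K].subtype = minpoly K (w : D)) (t : 𝒪[K]) :
    (splitting K D (1 - (t : K) • (w : D))).det =
      algebraMap K (AlgebraicClosure K) (p.reverse.eval t : 𝒪[K]) := by
  have hint : IsIntegral K (w : D) := Algebra.IsIntegral.isIntegral _
  set φ : 𝒪[K] →+* AlgebraicClosure K :=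
    (algebraMap K (AlgebraicClosure K)).comp 𝒪[K].subtype with hφ
  have hinj : Function.Injective 𝒪[K].subtype := Subtype.val_injective
  have hφinj : Function.Injective φ := (algebraMap K _).injective.comp hinj
  have hdm : (minpoly K (w : D)).natDegree = degree K D := by
    rw [← hp, natDegree_map_eq_of_injective hinj, hd]
  have hχ : (splitting K D w).charpoly = p.map φ := by
    rw [charpoly_splitting hdm, ← hp, map_map]
  have hrev : (splitting K D w).charpolyRev = p.reverse.map φ := by
    rw [← Matrix.reverse_charpoly, hχ, reverse, reverse, natDegree_map_eq_of_injective hφinj,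
      reflect_map]
  have h1 := congrArg (eval (φ t)) hrev
  rw [eval_map, eval₂_at_apply] at h1
  change _ = φ (p.reverse.eval t)
  rw [← h1, Matrix.charpolyRev, ← coe_evalRingHom, RingHom.map_det]
  congr 1
  ext i j
  simp [Matrix.one_apply, apply_ite, hφ]
  rw [Algebra.smul_def, mul_comm]

variable {π : intD K D} (hπ : Ideal.span {π} = maxD K D)
include hπ

/-- The reduced norm maps `1 + m_D ^ (rd)` onto `1 + m_K ^ r`. -/
theorem exists_det_splitting_eq {r : ℕ} (hr : r ≠ 0) {c : 𝒪[K]} (hc : c - 1 ∈ 𝓂[K] ^ r) :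
    ∃ u : intD K D, u - 1 ∈ maxD K D ^ (r * degree K D) ∧
      (splitting K D u).det = algebraMap K (AlgebraicClosure K) c := by
  obtain ⟨ϖ, hϖ⟩ := IsDiscreteValuationRing.exists_irreducible 𝒪[K]
  obtain ⟨hnorm, w, p, hpm, hpd, hp, hunit⟩ := exists_unit_trace hπ hϖ
  obtain ⟨b, hb⟩ : ∃ b, c = 1 + ϖ ^ r * b := by
    rw [Valued.maximalIdeal, hϖ.maximalIdeal_eq, Ideal.span_singleton_pow,
      Ideal.mem_span_singleton] at hc
    obtain ⟨b, hb⟩ := hc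
    exact ⟨b, by rw [← hb]; ring⟩
  obtain ⟨u, hu⟩ := hunit
  -- The constant term is the leading coefficient of `p`, and the linear term is the unit
  -- coefficient in degree `d - 1`.
  obtain ⟨R, hR⟩ : ∃ R : 𝒪[K][X], p.reverse = 1 + X * (C (u : 𝒪[K]) + X * R) := by
    have h0 : p.reverse.coeff 0 = 1 := by rw [coeff_zero_reverse, hpm.leadingCoeff]
    have h1 : p.reverse.coeff 1 = u := by
      rw [coeff_one_reverse, nextCoeff_of_natDegree_pos (by rw [hpd]; exact degree_pos K), hpd, hu]
    refine ⟨p.reverse.divX.divX, ?_⟩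
    conv_lhs => rw [← divX_mul_X_add p.reverse, ← divX_mul_X_add p.reverse.divX, coeff_divX, h0,
      zero_add, h1]
    rw [C_1]
    ring
  have hϖ1 : ‖ϖ ^ r‖ < 1 := by
    rw [norm_pow]
    exact pow_lt_one₀ (norm_nonneg _) (Valued.integer.norm_irreducible_lt_one hϖ) hr
  -- With `c = 1 + ϖ^r b` and `t = ϖ^r y`, the equation to solve is `u y + ϖ^r y² R(ϖ^r y) = b`,
  -- here put in fixed point form.
  obtain ⟨y, hy⟩ := exists_eq_add_mul_eval hϖ1 ((u⁻¹ : 𝒪[K]ˣ) * b)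
    (-(C ((u⁻¹ : 𝒪[K]ˣ) : 𝒪[K]) * X ^ 2 * R.comp (C (ϖ ^ r) * X)))
  have hval : p.reverse.eval (ϖ ^ r * y) = c := by
    rw [hR, hb]
    simp only [eval_neg, eval_mul, eval_C, eval_pow, eval_X, eval_comp] at hy
    simp only [eval_add, eval_one, eval_mul, eval_X, eval_C]
    generalize eval (ϖ ^ r * y) R = s at *
    have h1 : (u : 𝒪[K]) * y = b - ϖ ^ r * (y ^ 2 * s) := by
      conv_lhs => rw [hy]
      linear_combination (b - ϖ ^ r * (y ^ 2 * s)) * u.mul_inv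
    linear_combination ϖ ^ r * h1
  refine ⟨1 - baseInt K D (ϖ ^ r * y) * w, ?_, ?_⟩
  · rw [mem_maxD_pow_iff hπ, sub_sub_cancel_left]
    change absD K (-(algebraMap K D ((ϖ ^ r * y : 𝒪[K]) : K) * (w : D))) ≤ _
    rw [absD_neg, absD_mul, absD_algebraMap, mul_comm r, pow_mul, ← hnorm, ← norm_pow]
    refine mul_le_of_le_one_right (norm_nonneg _) (mem_intD_iff.1 w.2) |>.trans ?_
    rw [Subring.coe_mul, norm_mul, Subring.coe_pow]
    exact mul_le_of_le_one_right (norm_nonneg _) (Valued.integer.norm_le_one y)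
  · rw [← hval, ← det_one_sub_smul hpd hp, Algebra.smul_def]
    rfl

/-- The reduction `SL_2(O_D) → SL_2(O_D / m_D ^ (rd))` is surjective. -/
theorem reduction_surjective {r : ℕ} (hr : r ≠ 0) : Function.Surjective (reduction K D r) := by
  rintro ⟨z, g, hg, hg'⟩
  obtain ⟨hn, c, hc, hc1⟩ := hg'.inv K hr
  obtain ⟨u, hu, hdet⟩ := exists_det_splitting_eq hπ hr hc1
  have hnz : nrd K D 2 (inclMat K D g) ≠ 0 := by
    intro h
    rw [h, spectralNorm_zero] at hn
    exact zero_ne_one hn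
  -- A factor congruent to `1` whose reduced norm is the inverse of that of the lift `g`.
  set e : Matrix (Fin 2) (Fin 2) (intD K D) := !![u, 0; 0, 1] with he
  have hnrd : nrd K D 2 (inclMat K D (g * e)) = 1 := by
    have h1 : inclMat K D e = !![(u : D), 0; 0, 1] := by
      ext i j
      fin_cases i <;> fin_cases j <;> rfl
    rw [map_mul, map_mul, h1, nrd_lower, hdet, ← hc, map_one, Matrix.det_one, mul_one,
      mul_inv_cancel₀ hnz]
  obtain ⟨m, h1, h2, -⟩ := exists_inv K (valGE_inclMat K D (g * e)) (by rw [hnrd, spectralNorm_one])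
  obtain ⟨k, hk⟩ := exists_mat_eq h1 h2 hnrd
  have hkP : k ∈ P K D 0 := by
    change ValGE K (mat k) _
    rw [hk]
    exact valGE_inclMat K D _
  refine ⟨⟨k, hkP⟩, Subtype.ext (Units.ext ?_)⟩
  have hint : intMat K D ⟨k, hkP⟩ = g * e := inclMat_injective K D hk
  change redMat K D _ (intMat K D ⟨k, hkP⟩) = z.1
  have hred : redMat K D (r * degree K D) e = 1 := by
    have h3 : Ideal.Quotient.mk (maxD K D ^ (r * degree K D)) u = 1 := by
      rw [← map_one (Ideal.Quotient.mk _), Ideal.Quotient.eq]; exact hu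
    ext i j
    fin_cases i <;> fin_cases j <;> simp [redMat, he, h3]
  rw [hint, map_mul, hred, mul_one, hg]

end ReducedNorm

/-! ### Comparison of the local relation with the tree relation -/

section LocalTree

set_option linter.unusedSectionVars false

variable {K : Type*} {D : Type*} [NontriviallyNormedField K] [IsUltrametricDist K]
  [ProperSpace K] [DivisionRing D] [Algebra K D] [FiniteDimensional K D]
  [Algebra.IsCentral K D]

theorem val_le_val {x y : D} (hy : y ≠ 0) (h : absD K x ≤ absD K y) : val K y ≤ val K x := by
  rw [show val K y = (realVal K y : EReal) from if_neg hy, le_val_iff, realVal, neg_neg,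
    Real.exp_log (absD_pos K hy)]
  exact h

theorem realVal_pow (x : D) (n : ℕ) : realVal K (x ^ n) = n * realVal K x := by
  rw [realVal, realVal, absD_pow', Real.log_pow]; ring

theorem le_quoVal_mk {m : ℕ} (y : intD K D) :
    val K (y : D) ≤ quoVal K (Ideal.Quotient.mk (maxD K D ^ m) y) :=
  le_iSup₂_of_le y rfl le_rfl

theorem quoVal_nonneg {m : ℕ} (z : Quo K D m) : 0 ≤ quoVal K z := by
  obtain ⟨y, rfl⟩ := Ideal.Quotient.mk_surjective z
  exact le_trans y.2 (le_quoVal_mk y)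

theorem quoVal_zero {m : ℕ} : quoVal K (0 : Quo K D m) = ⊤ := by
  rw [← top_le_iff, ← map_zero (Ideal.Quotient.mk _)]
  refine le_trans ?_ (le_quoVal_mk 0)
  simp [val]

theorem quoVal_one {m : ℕ} (hm : m ≠ 0) : quoVal K (1 : Quo K D m) = 0 := by
  refine le_antisymm (iSup₂_le fun y hy => ?_) (quoVal_nonneg _)
  by_contra! h
  rw [← map_one (Ideal.Quotient.mk _), Ideal.Quotient.eq] at hy
  have h1 : (1 : intD K D) ∈ maxD K D := by
    have := (maxD K D).sub_mem (show y ∈ maxD K D from h) (Ideal.pow_le_self hm hy)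
    rwa [sub_sub_cancel] at this
  rw [mem_maxD_iff, Subring.coe_one, absD_one] at h1
  exact lt_irrefl _ h1

theorem mem_localP_of_diag {r : ℕ} {n : localSL2 K D r} (h1 : locMat K n 0 1 = 0)
    (h2 : locMat K n 1 0 = 0) (x : ℝ) : n ∈ localP K D r x := by
  intro i j
  fin_cases i <;> fin_cases j
  · simpa [levelMat] using quoVal_nonneg _
  · simp [h1, quoVal_zero]
  · simp [h2, quoVal_zero]
  · simpa [levelMat] using quoVal_nonneg _

theorem locMat_reduction {r : ℕ} (g : P K D 0) (i j : Fin 2) :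
    locMat K (reduction K D r g) i j = Ideal.Quotient.mk _ (intMat K D g i j) := rfl

variable (K D) in
/-- The matrix `(0, -1; 1, 0)` in `SL_2(O_D)`. -/
def intWeyl : P K D 0 := ⟨weyl, weyl_mem⟩

theorem locMat_weyl {r : ℕ} : locMat K (reduction K D r (intWeyl K D)) = !![0, -1; 1, 0] := by
  have h : intMat K D (intWeyl K D) = !![0, -1; 1, 0] :=
    inclMat_injective K D ((inclMat_intMat K D _).trans (mat_weyl.trans (by
      ext i j
      fin_cases i <;> fin_cases j <;> simp [inclMat])))
  ext i j
  rw [locMat_reduction, h]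
  fin_cases i <;> fin_cases j <;> simp

variable {π : intD K D} (hπ : Ideal.span {π} = maxD K D)
include hπ

/-- Below the threshold `ω(π^m)` the choice of lift is irrelevant: if `ω(y) < c`, then `y` is larger
than any element of `m_D^m`, so no lift of its class is smaller than `y`. -/
theorem le_quoVal_mk_iff {m : ℕ} {c : ℝ} (hc : c ≤ realVal K ((π : D) ^ m)) (y : intD K D) :
    (c : EReal) ≤ quoVal K (Ideal.Quotient.mk (maxD K D ^ m) y) ↔ (c : EReal) ≤ val K (y : D) := by
  refine ⟨fun h => ?_, fun h => h.trans (le_quoVal_mk y)⟩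
  by_contra hlt
  have hy := hlt
  rw [le_val_iff, not_le] at hy
  refine hlt (h.trans (iSup₂_le fun y' hy' => ?_))
  rw [Ideal.Quotient.eq, mem_maxD_pow_iff hπ] at hy'
  have h1 : absD K (π : D) ^ m ≤ Real.exp (-c) := by
    rw [realVal, absD_pow'] at hc
    rw [← Real.log_le_iff_le_exp (pow_pos (uniformiser_pos hπ) m)]
    linarith
  have h2 : absD K (y : D) ≤ absD K (y' : D) := by
    have h3 := absD_sub_le K (y' : D) ((y' - y : intD K D) : D)
    rw [AddSubgroupClass.coe_sub, sub_sub_cancel] at h3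
    rcases le_max_iff.1 h3 with h3 | h3
    · exact h3
    · exact absurd (h3.trans (hy'.trans h1)) (not_le.2 hy)
  refine val_le_val ?_ h2
  intro h0
  rw [h0, absD_zero] at h2
  exact absurd (hy.trans_le h2) (not_lt.2 (Real.exp_pos _).le)

/-- The interval is chosen for this: both `x` and `-x` stay within the threshold `ω(π^(rd))`. -/
theorem reduction_mem_localP_iff {r : ℕ} (g : P K D 0) (x : interval K π r) :
    reduction K D r g ∈ localP K D r x ↔ (g : SL2 K D) ∈ P K D x := by
  obtain ⟨x, hx1, hx2⟩ := x
  refine forall_congr' fun i => forall_congr' fun j => ?_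
  rw [locMat_reduction, le_quoVal_mk_iff hπ]
  · rfl
  · fin_cases i <;> fin_cases j <;> simp [levelMat] <;> linarith

theorem localRel_iff {r : ℕ} (hr : r ≠ 0) (g h : P K D 0) (x y : interval K π r) :
    LocalRel K π r (reduction K D r g, x) (reduction K D r h, y) ↔
      TreeRel K D ((g : SL2 K D), (x : ℝ)) ((h : SL2 K D), (y : ℝ)) := by
  have hrd : r * degree K D ≠ 0 := mul_ne_zero hr (degree_pos K).ne'
  have hone : quoVal K (1 : Quo K D (r * degree K D)) = 0 := quoVal_one hrd
  have hMH : ∀ n ∈ localM K D r, n ∉ localH K D r := by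
    rintro n ⟨u, -, hn⟩ ⟨v, hv, hn'⟩
    have h1 := congrFun (congrFun (hn'.symm.trans hn) 0) 0
    simp only [Matrix.of_apply, Matrix.cons_val', Matrix.cons_val_zero,
      Matrix.cons_val_fin_one] at h1
    rw [h1, quoVal_zero] at hv
    exact absurd hv EReal.top_ne_zero
  have hnuH : ∀ n ∈ localH K D r, ∀ t : ℝ, localNu K n t = t := fun n hn t => by
    rw [localNu, if_pos hn]; rfl
  have hnuM : ∀ n ∈ localM K D r, ∀ t : ℝ, localNu K n t = -t := fun n hn t => by
    rw [localNu, if_neg (hMH n hn), AffineEquiv.pointReflection_apply]; simp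
  rw [treeRel_integral_iff g.2 h.2]
  constructor
  · rintro ⟨n, hn, h1, h2⟩
    obtain ⟨m, rfl⟩ := reduction_surjective hπ hr n
    simp only at h1 h2
    rw [← map_inv, ← map_mul, ← map_mul, reduction_mem_localP_iff hπ] at h2
    rcases hn with hn | hn
    · left
      rw [hnuH _ hn] at h1
      refine ⟨h1.symm, ?_⟩
      obtain ⟨u, -, hu⟩ := hn
      -- The lift `m` need not be diagonal, but its off-diagonal entries vanish modulo `m_D^(rd)`;
      -- that suffices for it to lie in `P_x` and be cancelled.
      have h3 : (m : SL2 K D) ∈ P K D x := (reduction_mem_localP_iff hπ m x).1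
        (mem_localP_of_diag (by rw [hu]; rfl) (by rw [hu]; rfl) x)
      exact (mul_mem_cancel_right h3).1 h2
    · right
      rw [hnuM _ hn] at h1
      refine ⟨h1.symm, ?_⟩
      obtain ⟨u, -, hu⟩ := hn
      -- Splitting off the Weyl element leaves a factor `s` that is diagonal after reduction, to be
      -- cancelled as before.
      obtain ⟨s, rfl⟩ : ∃ s, m = intWeyl K D * s := ⟨(intWeyl K D)⁻¹ * m, by group⟩
      have h4 : locMat K (reduction K D r (intWeyl K D * s)) =
          !![0, -1; 1, 0] * locMat K (reduction K D r s) := by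
        rw [map_mul, ← locMat_weyl]; rfl
      rw [h4, Matrix.eta_fin_two (locMat K (reduction K D r s)), Matrix.mul_fin_two] at hu
      have h5 := congrFun (congrFun hu 0) 0
      have h6 := congrFun (congrFun hu 1) 1
      simp at h5 h6
      have h3 : (s : SL2 K D) ∈ P K D x := (reduction_mem_localP_iff hπ s x).1
        (mem_localP_of_diag h6 h5 x)
      rw [← mul_assoc] at h2
      exact (mul_mem_cancel_right h3).1 h2
  · rintro (⟨h1, h2⟩ | ⟨h1, h2⟩)
    · have hH : (1 : localSL2 K D r) ∈ localH K D r := ⟨1, hone, by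
        rw [inv_one, Units.val_one]; exact Matrix.one_fin_two⟩
      refine ⟨1, Or.inl hH, by rw [hnuH _ hH]; exact h1.symm, ?_⟩
      rw [mul_one]
      exact (reduction_mem_localP_iff hπ (g⁻¹ * h) x).2 h2
    · have hM : reduction K D r (intWeyl K D) ∈ localM K D r := ⟨1, hone, by
        rw [locMat_weyl]; simp⟩
      refine ⟨_, Or.inr hM, by rw [hnuM _ hM]; exact h1.symm, ?_⟩
      exact (reduction_mem_localP_iff hπ (g⁻¹ * h * intWeyl K D) x).2 h2

omit hπ in
theorem subsingleton_localSL2_zero : Subsingleton (localSL2 K D 0) := by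
  have : Subsingleton (Quo K D (0 * degree K D)) := by
    rw [Ideal.Quotient.subsingleton_iff, zero_mul, Submodule.pow_zero, Ideal.one_eq_top]
  exact ⟨fun a b => Subtype.ext (Units.ext (Subsingleton.elim _ _))⟩

omit hπ in
theorem interval_zero (x : interval K π 0) : (x : ℝ) = 0 := by
  obtain ⟨x, hx1, hx2⟩ := x
  rw [realVal_pow] at hx1 hx2
  simp only [zero_mul, Nat.cast_zero, neg_zero] at hx1 hx2
  exact le_antisymm hx2 hx1

theorem localTree_mk_eq_iff {r : ℕ} (g h : P K D 0) (x y : interval K π r) :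
    LocalTree.mk K π r (reduction K D r g) x = LocalTree.mk K π r (reduction K D r h) y ↔
      Tree.mk K (g : SL2 K D) x = Tree.mk K (h : SL2 K D) y := by
  rcases eq_or_ne r 0 with rfl | hr
  -- For `r = 0` the only class has valuation `∞`, so `localN` is empty and `LocalRel` is not
  -- reflexive; but the group is trivial and the interval is `{0}`, so both sides hold outright.
  · have := subsingleton_localSL2_zero (K := K) (D := D)
    rw [interval_zero x, interval_zero y, mk_integral_zero g.2, mk_integral_zero h.2,
      Subsingleton.elim (reduction K D 0 g) (reduction K D 0 h),
      Subtype.ext ((interval_zero x).trans (interval_zero y).symm)]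
    exact ⟨fun _ => rfl, fun _ => rfl⟩
  · have hsurj := reduction_surjective hπ hr
    -- The equivalence axioms are transported from the tree, since every local pair lifts.
    have hE : Equivalence (LocalRel K π r) :=
      { refl := fun p => by
          obtain ⟨g, x⟩ := p
          obtain ⟨g, rfl⟩ := hsurj g
          exact (localRel_iff hπ hr g g x x).2 (treeRel_equivalence.refl _)
        symm := fun {p q} hpq => by
          obtain ⟨g, x⟩ := p
          obtain ⟨h, y⟩ := q
          obtain ⟨g, rfl⟩ := hsurj g
          obtain ⟨h, rfl⟩ := hsurj h
          rw [localRel_iff hπ hr] at hpq ⊢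
          exact treeRel_equivalence.symm hpq
        trans := fun {p q s} hpq hqs => by
          obtain ⟨g, x⟩ := p
          obtain ⟨h, y⟩ := q
          obtain ⟨k, z⟩ := s
          obtain ⟨g, rfl⟩ := hsurj g
          obtain ⟨h, rfl⟩ := hsurj h
          obtain ⟨k, rfl⟩ := hsurj k
          rw [localRel_iff hπ hr] at hpq hqs ⊢
          exact treeRel_equivalence.trans hpq hqs }
    rw [Tree.mk_eq_iff, ← localRel_iff hπ hr]
    exact hE.quot_mk_eq_iff _ _

theorem exists_localTree_mk {r : ℕ} (q : LocalTree K π r) :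
    ∃ (g : P K D 0) (x : interval K π r), LocalTree.mk K π r (reduction K D r g) x = q := by
  induction q using Quot.ind with
  | mk p =>
    obtain ⟨h, x⟩ := p
    rcases eq_or_ne r 0 with rfl | hr
    · have := subsingleton_localSL2_zero (K := K) (D := D)
      exact ⟨1, x, by rw [Subsingleton.elim (reduction K D 0 1) h]; rfl⟩
    · obtain ⟨g, rfl⟩ := reduction_surjective hπ hr h
      exact ⟨g, x, rfl⟩

theorem mem_ball_iff (r : ℕ) (p : Tree K D) : p ∈ ball K π (r * degree K D) ↔
    ∃ (g : P K D 0) (x : interval K π r), Tree.mk K (g : SL2 K D) x = p := by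
  have hω : 0 < realVal K (π : D) := by
    rw [realVal, neg_pos]
    exact Real.log_neg (uniformiser_pos hπ) (absD_uniformiser_lt hπ)
  have key : ∀ (g : P K D 0) (x : ℝ),
      Tree.mk K (g : SL2 K D) x ∈ ball K π (r * degree K D) ↔ x ∈ interval K π r := by
    intro g x
    change treeDist K π (Tree.mk K 1 0) (Tree.mk K (g : SL2 K D) x) ≤ _ ↔ _
    rw [treeDist_integral π g.2, ENNReal.ofReal_le_natCast, div_le_iff₀ hω, ← realVal_pow, abs_le]
    rfl
  constructor
  · intro hp
    obtain ⟨g, hg, x, rfl⟩ := exists_integral_of_treeDist π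
      (ne_top_of_le_ne_top (ENNReal.natCast_ne_top _) hp)
    exact ⟨⟨g, hg⟩, ⟨x, (key ⟨g, hg⟩ x).1 hp⟩, rfl⟩
  · rintro ⟨g, x, rfl⟩
    exact (key g x).2 x.2

end LocalTree

end

end BTTree

/-! ### The equivariant bijection -/

theorem mainTheorem9 {K : Type*} [NontriviallyNormedField K] [IsUltrametricDist K] [ProperSpace K]
    {D : Type*} [DivisionRing D] [Algebra K D] [FiniteDimensional K D] [Algebra.IsCentral K D]
    (π : BTTree.intD K D) (hπ : Ideal.span {π} = BTTree.maxD K D) (r : ℕ) :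
    (∀ p : BTTree.Tree K D, p ∈ BTTree.ball K π (r * BTTree.degree K D) ↔
      ∃ (g : BTTree.P K D 0) (x : BTTree.interval K π r), BTTree.Tree.mk K (g : BTTree.SL2 K D) x = p) ∧
    ∃ F : BTTree.ball K π (r * BTTree.degree K D) → BTTree.LocalTree K π r,
      Function.Bijective F ∧
      (∀ (g : BTTree.P K D 0) (x : BTTree.interval K π r)
        (h : BTTree.Tree.mk K (g : BTTree.SL2 K D) x ∈ BTTree.ball K π (r * BTTree.degree K D)),
        F ⟨BTTree.Tree.mk K (g : BTTree.SL2 K D) x, h⟩ =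
          BTTree.LocalTree.mk K π r (BTTree.reduction K D r g) x) ∧
      ∀ (k : BTTree.P K D 0) (p : BTTree.ball K π (r * BTTree.degree K D)),
        ∃ h : (k : BTTree.SL2 K D) • (p : BTTree.Tree K D) ∈
            BTTree.ball K π (r * BTTree.degree K D),
          F ⟨(k : BTTree.SL2 K D) • (p : BTTree.Tree K D), h⟩ =
            BTTree.reduction K D r k • F p := by
  have hball := BTTree.mem_ball_iff hπ r
  refine ⟨hball, ?_⟩
  choose g x hgx using fun p : BTTree.ball K π (r * BTTree.degree K D) => (hball p).1 p.2
  -- `F` uses chosen representatives; `localTree_mk_eq_iff` shows independence of the choice in one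
  -- direction and injectivity in the other.
  let F : BTTree.ball K π (r * BTTree.degree K D) → BTTree.LocalTree K π r :=
    fun p => BTTree.LocalTree.mk K π r (BTTree.reduction K D r (g p)) (x p)
  have hF : ∀ (h : BTTree.P K D 0) (y : BTTree.interval K π r)
      (hy : BTTree.Tree.mk K (h : BTTree.SL2 K D) y ∈ BTTree.ball K π (r * BTTree.degree K D)),
      F ⟨BTTree.Tree.mk K (h : BTTree.SL2 K D) y, hy⟩ =
        BTTree.LocalTree.mk K π r (BTTree.reduction K D r h) y := fun h y hy =>
    (BTTree.localTree_mk_eq_iff hπ _ _ _ _).2 (hgx ⟨_, hy⟩)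
  refine ⟨F, ⟨fun p q hpq => ?_, fun q => ?_⟩, hF, fun k p => ?_⟩
  · rw [Subtype.ext_iff, ← hgx p, ← hgx q]
    exact (BTTree.localTree_mk_eq_iff hπ _ _ _ _).1 hpq
  · obtain ⟨h, y, rfl⟩ := BTTree.exists_localTree_mk hπ q
    exact ⟨⟨_, (hball _).2 ⟨h, y, rfl⟩⟩, hF h y _⟩
  · obtain ⟨p, hp⟩ := p
    obtain ⟨h, y, rfl⟩ := (hball p).1 hp
    have hk : BTTree.Tree.mk K ((k * h : BTTree.P K D 0) : BTTree.SL2 K D) y ∈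
        BTTree.ball K π (r * BTTree.degree K D) := (hball _).2 ⟨k * h, y, rfl⟩
    refine ⟨hk, (hF (k * h) y hk).trans ?_⟩
    rw [hF h y hp, map_mul]
    rfl
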